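/- For an algebraic subgroup $\mathbf M<\mathrm{SL}_N$ defined over $\mathbb Q$ with rational Lie algebra $\mathfrak m\subset\mathfrak{sl}_N(\mathbb Q)$ and $d=\dim\mathbf M=\dim\mathfrak m$, let $v_{\mathbf M}$ be a primitive integral vector (unique up to sign) in the line $\bigwedge^{d}\mathfrak m\subset\bigwedge^{d}\mathfrak{sl}_N(\mathbb Q)$, with respect to the integral structure induced by $\mathfrak{sl}_N(\mathbb Z)$. Given a Euclidean norm $\|\cdot\|$ on $\mathrm{Mat}_N(\mathbb R)$, define the height $\mathrm{ht}(\mathbf M)=\|v_{\mathbf M}\|$, where the norm on $\bigwedge^{d}\mathfrak{sl}_N(\mathbb R)$ is the Euclidean norm induced by $\|\cdot\|$ (so $\|x_1\wedge\dots\wedge x_d\|^2=\det(\langle x_i,x_j\rangle)$). **Lemma (Heights of normal subgroups).** For every $N$ there is an exponent $k>0$ depending only on $N$, and for every Euclidean norm on $\mathrm{Mat}_N(\mathbb R)$ there is a constant $C>0$ depending only on $N$ and the norm, such that the following holds. If $\mathbf M<\mathrm{SL}_N$ is a semisimple $\mathbb Q$-subgroup (i.e. a $\mathbb Q$-subgroup,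 not necessarily connected, with trivial radical) and $\mathbf M'\triangleleft\mathbf M$ is a normal $\mathbb Q$-subgroup, then $$\mathrm{ht}(\mathbf M')\le C\,\mathrm{ht}(\mathbf M)^{k}.$$ -/

import Mathlib

noncomputable section

open MvPolynomial LieAlgebra.SpecialLinear

namespace HeightNormal

/-- Polynomials in the matrix entries `x_{ij}`. -/
abbrev EntryPoly (N : ℕ) (R : Type) [CommSemiring R] : Type := MvPolynomial (Fin N × Fin N) R

/-- The complex points of the ambient algebraic group `SL_N`. -/
abbrev SLN (N : ℕ) : Type := Matrix.SpecialLinearGroup (Fin N) ℂ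

/-- The matrix entries of `g`, i.e. `g` as a point of affine `N²`-space. -/
def entries {N : ℕ} (g : SLN N) : Fin N × Fin N → ℂ := fun ij => g.1 ij.1 ij.2

/-- Zariski closed subsets of `SL_N(ℂ)`. -/
def IsZariskiClosed {N : ℕ} (A : Set (SLN N)) : Prop :=
  ∃ S : Set (EntryPoly N ℂ), A = {g | ∀ p ∈ S, eval (entries g) p = 0}

/-- Connectedness (for a nonempty set) in the Zariski topology: the set is not the union of two
disjoint nonempty relatively closed subsets. -/
def IsZariskiConnected {N : ℕ} (R : Set (SLN N)) : Prop :=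
  ∀ A B : Set (SLN N), IsZariskiClosed A → IsZariskiClosed B →
    R ⊆ A ∪ B → R ∩ (A ∩ B) = ∅ → R ⊆ A ∨ R ⊆ B

/-- The ideal of all complex polynomials in the matrix entries that vanish on `A`. -/
def idealOf {N : ℕ} (A : Set (SLN N)) : Ideal (EntryPoly N ℂ) :=
  vanishingIdeal ℂ (entries '' A)

/-- `M` is (the group of complex points of) an algebraic subgroup of `SL_N` defined over `ℚ`:
it is Zariski closed and its vanishing ideal is generated by polynomials with rational
coefficients. -/
def IsQSubgroup {N : ℕ} (M : Subgroup (SLN N)) : Prop :=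
  IsZariskiClosed (M : Set (SLN N)) ∧
    ∃ S : Set (EntryPoly N ℚ),
      idealOf (M : Set (SLN N)) = Ideal.span (MvPolynomial.map (algebraMap ℚ ℂ) '' S)

/-- `M` has trivial radical: every Zariski closed, connected, solvable, normal subgroup of `M`
is trivial. -/
def IsSemisimpleGroup {N : ℕ} (M : Subgroup (SLN N)) : Prop :=
  ∀ R : Subgroup (SLN N), R ≤ M → (R.subgroupOf M).Normal →
    IsZariskiClosed (R : Set (SLN N)) → IsZariskiConnected (R : Set (SLN N)) →
    Group.IsSolvable R → R = ⊥

/-- The rational Lie algebra of `M`: the traceless rational matrices in the tangent space at the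
identity, i.e. those annihilated by the differential at the identity of every polynomial
vanishing on `M`. -/
def lieAlg {N : ℕ} (M : Subgroup (SLN N)) : Submodule ℚ (sl (Fin N) ℚ) where
  carrier := {X | ∀ p ∈ idealOf (M : Set (SLN N)),
    ∑ ij : Fin N × Fin N,
      eval (entries (1 : SLN N)) (pderiv ij p) * ((X.1 ij.1 ij.2 : ℚ) : ℂ) = 0}
  zero_mem' := by intro p _; simp
  add_mem' := by
    intro X Y hX hY p hp
    simpa [mul_add, Finset.sum_add_distrib] using congrArg₂ (· + ·) (hX p hp) (hY p hp)
  smul_mem' := by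
    intro c X hX p hp
    have := congrArg (fun z => (c : ℂ) * z) (hX p hp)
    simpa [Finset.mul_sum, mul_left_comm] using this

/-- The dimension of `M`. -/
def gdim {N : ℕ} (M : Subgroup (SLN N)) : ℕ := Module.finrank ℚ (lieAlg M)

/-- The inclusion of `sl_N(ℤ)` into `sl_N(ℚ)`. -/
def slCast (N : ℕ) : sl (Fin N) ℤ →ₗ[ℤ] sl (Fin N) ℚ where
  toFun X := ⟨X.1.map (Int.cast : ℤ → ℚ), by
    have h : Matrix.trace X.1 = 0 := LinearMap.mem_ker.mp X.2
    refine LinearMap.mem_ker.mpr ?_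
    have := congrArg (Int.cast : ℤ → ℚ) h
    simpa [Matrix.trace] using this⟩
  map_add' X Y := by ext i j; simp
  map_smul' c X := by ext i j; simp [← zsmul_eq_mul]

/-- The alternating map `(X₁, …, X_d) ↦ f X₁ ∧ ⋯ ∧ f X_d` over a smaller ring of scalars. -/
def wedgeOver {R K V W : Type} [CommRing R] [CommRing K] [AddCommGroup V] [Module R V]
    [AddCommGroup W] [Module K W] [Module R W] [Algebra R K] [IsScalarTower R K W]
    (f : V →ₗ[R] W) (d : ℕ) : V [⋀^Fin d]→ₗ[R] (⋀[K]^d W) :=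
  { ((exteriorPower.ιMulti K d (M := W)).toMultilinearMap.restrictScalars R).compLinearMap
      (fun _ => f) with
    map_eq_zero_of_eq' := fun v _ _ h hij =>
      (exteriorPower.ιMulti K d (M := W)).map_eq_zero_of_eq (fun i => f (v i))
        (congrArg f h) hij }

/-- The integral structure on the `d`-th exterior power of `sl_N(ℚ)` induced by `sl_N(ℤ)`. -/
def wedgeLattice (N d : ℕ) : Submodule ℤ (⋀[ℚ]^d (sl (Fin N) ℚ)) :=
  Submodule.span ℤ
    (Set.range fun X : Fin d → sl (Fin N) ℤ => exteriorPower.ιMulti ℚ d fun i => slCast N (X i))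

/-- The line in the exterior power of `sl_N(ℚ)` given by the top exterior power of the Lie algebra
of `M`. -/
def wedgeLine {N : ℕ} (M : Subgroup (SLN N)) : Submodule ℚ (⋀[ℚ]^(gdim M) (sl (Fin N) ℚ)) :=
  LinearMap.range (exteriorPower.map (gdim M) (lieAlg M).subtype)

/-- `v` is a primitive integral vector of the line attached to `M`. -/
def IsPrimitiveVec {N : ℕ} (M : Subgroup (SLN N)) (v : ⋀[ℚ]^(gdim M) (sl (Fin N) ℚ)) : Prop :=
  v ∈ wedgeLine M ∧ v ∈ wedgeLattice N (gdim M) ∧ v ≠ 0 ∧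
    ∀ (n : ℤ), ∀ w ∈ wedgeLattice N (gdim M), v = n • w → IsUnit n

theorem wedgeLattice_fg (N d : ℕ) : (wedgeLattice N d).FG := by
  classical
  have : Module.Finite ℤ (sl (Fin N) ℤ) := by
    exact Module.Finite.of_injective
      ((Matrix.traceLinearMap (Fin N) ℤ ℤ).ker.subtype) Subtype.val_injective
  let f : (⋀[ℤ]^d (sl (Fin N) ℤ)) →ₗ[ℤ] (⋀[ℚ]^d (sl (Fin N) ℚ)) :=
    exteriorPower.alternatingMapLinearEquiv
      (wedgeOver (K := ℚ) (slCast N) d)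
  have hf : wedgeLattice N d = LinearMap.range f := by
    rw [LinearMap.range_eq_map, ← exteriorPower.ιMulti_span, Submodule.map_span, ← Set.range_comp]
    unfold wedgeLattice
    congr 1
    ext x
    simp only [Set.mem_range, Function.comp_apply, f,
      exteriorPower.alternatingMapLinearEquiv_apply_ιMulti]
    exact Iff.rfl
  rw [hf]
  have := Module.Finite.range f
  exact Module.Finite.iff_fg.mp this

theorem exists_smul_mem_wedgeLattice (N d : ℕ) (v : ⋀[ℚ]^d (sl (Fin N) ℚ)) :
    ∃ n : ℤ, n ≠ 0 ∧ n • v ∈ wedgeLattice N d := by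
  have hX : ∀ X : sl (Fin N) ℚ, ∃ n : ℤ, n ≠ 0 ∧ ∃ Y, n • X = slCast N Y := by
    intro X
    obtain ⟨b, hb⟩ := IsLocalization.exist_integer_multiples_of_finite (nonZeroDivisors ℤ)
      (fun ij : Fin N × Fin N => X.1 ij.1 ij.2)
    choose y hy using hb
    have htr : Matrix.trace X.1 = 0 := LinearMap.mem_ker.mp X.2
    refine ⟨b, nonZeroDivisors.coe_ne_zero b, ⟨Matrix.of fun i j => y (i, j), ?_⟩, ?_⟩
    · refine LinearMap.mem_ker.mpr ?_
      apply Int.cast_injective (α := ℚ)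
      have : ((b : ℤ) : ℚ) * Matrix.trace X.1 = 0 := by rw [htr, mul_zero]
      simp only [Matrix.trace, Finset.mul_sum, Matrix.diag_apply] at this
      simp only [Matrix.traceLinearMap_apply, Matrix.trace, Matrix.diag_apply, Matrix.of_apply,
        Int.cast_sum, Int.cast_zero]
      rw [← this]
      refine Finset.sum_congr rfl fun i _ => ?_
      simpa using hy (i, i)
    · ext i j
      simpa [slCast] using (hy (i, j)).symm
  have hv : v ∈ Submodule.span ℚ (Set.range (exteriorPower.ιMulti ℚ d (M := sl (Fin N) ℚ))) := by
    rw [exteriorPower.ιMulti_span]; trivial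
  induction hv using Submodule.span_induction with
  | mem x hx =>
    obtain ⟨X, rfl⟩ := hx
    choose n hn Y hY using fun i => hX (X i)
    refine ⟨∏ i, n i, Finset.prod_ne_zero_iff.mpr fun i _ => hn i, ?_⟩
    have h : (∏ i, n i) • exteriorPower.ιMulti ℚ d X
        = exteriorPower.ιMulti ℚ d fun i => slCast N (Y i) := by
      have := ((exteriorPower.ιMulti ℚ d (M := sl (Fin N) ℚ)).toMultilinearMap.restrictScalars
        ℤ).map_smul_univ n X
      simp only [← hY]
      exact this.symm
    rw [h]
    exact Submodule.subset_span ⟨Y, rfl⟩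
  | zero => exact ⟨1, one_ne_zero, by simp⟩
  | add x y _ _ hx hy =>
    obtain ⟨m, hm, hx⟩ := hx
    obtain ⟨n, hn, hy⟩ := hy
    refine ⟨m * n, mul_ne_zero hm hn, ?_⟩
    rw [smul_add, mul_comm m n, mul_smul, mul_comm n m, mul_smul]
    exact add_mem (Submodule.smul_mem _ _ hx) (Submodule.smul_mem _ _ hy)
  | smul c x _ hx =>
    obtain ⟨n, hn, hx⟩ := hx
    refine ⟨c.den * n, mul_ne_zero (by exact_mod_cast c.den_nz) hn, ?_⟩
    have : ((c.den : ℤ) * n) • c • x = c.num • n • x := by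
      simp only [← Int.cast_smul_eq_zsmul ℚ, smul_smul]
      congr 1
      push_cast
      rw [mul_right_comm, Rat.den_mul_eq_num]
    rw [this]
    exact Submodule.smul_mem _ _ hx

theorem exists_ne_zero_mem_wedgeLine {N : ℕ} (M : Subgroup (SLN N)) :
    ∃ v ∈ wedgeLine M, v ≠ 0 := by
  have hinj := exteriorPower.map_injective_field (n := gdim M)
    (lieAlg M).subtype_injective
  have hr : 0 < Module.finrank ℚ (⋀[ℚ]^(gdim M) (lieAlg M)) := by
    rw [exteriorPower.finrank_eq, gdim, Nat.choose_self]; exact one_pos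
  have := Module.nontrivial_of_finrank_pos hr
  obtain ⟨x, hx⟩ := exists_ne (0 : ⋀[ℚ]^(gdim M) (lieAlg M))
  exact ⟨_, ⟨x, rfl⟩, fun h => hx (hinj (by rw [h, map_zero]))⟩

theorem exists_isPrimitiveVec {N : ℕ} (M : Subgroup (SLN N)) : ∃ v, IsPrimitiveVec M v := by
  classical
  let P : Submodule ℤ (⋀[ℚ]^(gdim M) (sl (Fin N) ℚ)) :=
    (wedgeLine M).restrictScalars ℤ ⊓ wedgeLattice N (gdim M)
  have hfin : Module.Finite ℤ P := by
    have := Module.Finite.iff_fg.mpr (wedgeLattice_fg N (gdim M))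
    have : IsNoetherian ℤ P :=
      isNoetherian_of_le (t := wedgeLattice N (gdim M)) inf_le_right
    infer_instance
  have htf0 : Module.IsTorsionFree ℤ (⋀[ℚ]^(gdim M) (sl (Fin N) ℚ)) :=
    Module.IsTorsionFree.trans_faithfulSMul ℤ ℚ _
  have htf : Module.IsTorsionFree ℤ P :=
    Function.Injective.moduleIsTorsionFree Subtype.val Subtype.val_injective fun _ _ => rfl
  have hfree : Module.Free ℤ P := inferInstance
  let b := Module.Free.chooseBasis ℤ P
  obtain ⟨v, hv, hv0⟩ := exists_ne_zero_mem_wedgeLine M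
  obtain ⟨n, hn, hnv⟩ := exists_smul_mem_wedgeLattice N (gdim M) v
  have hnt : Nontrivial P := by
    refine ⟨⟨⟨n • v, ?_, hnv⟩, 0, ?_⟩⟩
    · exact Submodule.smul_mem ((wedgeLine M).restrictScalars ℤ) n hv
    · intro h
      exact (smul_ne_zero hn hv0) (congrArg Subtype.val h)
  have hne : Nonempty (Module.Free.ChooseBasisIndex ℤ P) := b.index_nonempty
  obtain ⟨i⟩ := hne
  refine ⟨(b i : ⋀[ℚ]^(gdim M) (sl (Fin N) ℚ)), (b i).2.1, (b i).2.2, ?_, ?_⟩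
  · intro h
    exact b.ne_zero i (Subtype.ext h)
  · intro m w hw h
    have hm : m ≠ 0 := by
      rintro rfl
      rw [zero_smul] at h
      exact b.ne_zero i (Subtype.ext h)
    have hwL : w ∈ wedgeLine M := by
      have h1 : w = ((m : ℚ)⁻¹) • (b i : ⋀[ℚ]^(gdim M) (sl (Fin N) ℚ)) := by
        rw [h, ← Int.cast_smul_eq_zsmul ℚ, smul_smul, inv_mul_cancel₀ (by exact_mod_cast hm),
          one_smul]
      rw [h1]
      exact Submodule.smul_mem _ _ (b i).2.1
    have h2 : b i = m • (⟨w, hwL, hw⟩ : P) := Subtype.ext h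
    have h3 := congrArg (fun z => b.repr z i) h2
    simp only [Module.Basis.repr_self, Finsupp.single_eq_same, map_smul, Finsupp.smul_apply,
      smul_eq_mul] at h3
    exact IsUnit.of_mul_eq_one _ h3.symm

/-- The primitive integral vector `v_M` (determined up to sign). -/
def wedgeVec {N : ℕ} (M : Subgroup (SLN N)) : ⋀[ℚ]^(gdim M) (sl (Fin N) ℚ) :=
  Classical.choose (exists_isPrimitiveVec M)

/-- The inclusion of `sl_N(ℚ)` into the real `N × N` matrices. -/
def slToReal (N : ℕ) : sl (Fin N) ℚ →ₗ[ℚ] Matrix (Fin N) (Fin N) ℝ where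
  toFun X := X.1.map (Rat.cast : ℚ → ℝ)
  map_add' X Y := by ext i j; simp
  map_smul' c X := by ext i j; simp [Rat.smul_def]

/-- The induced map of exterior powers,
`X₁ ∧ ⋯ ∧ X_d ↦ X₁ ∧ ⋯ ∧ X_d`. -/
def wedgeToReal (N d : ℕ) :
    (⋀[ℚ]^d (sl (Fin N) ℚ)) →ₗ[ℚ] (⋀[ℝ]^d (Matrix (Fin N) (Fin N) ℝ)) :=
  exteriorPower.alternatingMapLinearEquiv
    (wedgeOver (K := ℝ) (slToReal N) d)

/-- `B` is a (Euclidean) inner product. -/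
def IsInnerProduct {V : Type} [AddCommGroup V] [Module ℝ V] (B : V →ₗ[ℝ] V →ₗ[ℝ] ℝ) : Prop :=
  (∀ x y, B x y = B y x) ∧ ∀ x, x ≠ 0 → 0 < B x x

/-- The bilinear form induced by `B` on the `d`-th exterior power, characterised by
`⟨x₁ ∧ ⋯ ∧ x_d, y₁ ∧ ⋯ ∧ y_d⟩ = det (B xᵢ yⱼ)`. -/
def wedgeForm {V : Type} [AddCommGroup V] [Module ℝ V] (B : V →ₗ[ℝ] V →ₗ[ℝ] ℝ) (d : ℕ) :
    (⋀[ℝ]^d V) →ₗ[ℝ] (⋀[ℝ]^d V) →ₗ[ℝ] ℝ :=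
  exteriorPower.pairingDual ℝ V d ∘ₗ exteriorPower.map d B

/-- The height of `M`: the Euclidean norm of `v_M`, for the norm on the exterior power induced by
the inner product `B` on real `N × N` matrices. -/
def height {N : ℕ} (B : Matrix (Fin N) (Fin N) ℝ →ₗ[ℝ] Matrix (Fin N) (Fin N) ℝ →ₗ[ℝ] ℝ)
    (M : Subgroup (SLN N)) : ℝ :=
  √(wedgeForm B (gdim M) (wedgeToReal N (gdim M) (wedgeVec M))
    (wedgeToReal N (gdim M) (wedgeVec M)))

end HeightNormal

end

noncomputable section

open MvPolynomial LieAlgebra.SpecialLinear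

namespace HeightNormal

/-! ### Polynomial functions along curves -/

/-! Write `𝔪` and `𝔪'` for the rational Lie algebras of `M` and `M'`. Since `M'` is normal, `𝔪'` is
an ideal of `𝔪`, and since `M` is semisimple, the Killing form `κ` of `𝔪` is nondegenerate. Hence `𝔪
= 𝔪' ⊕ 𝔪'^⊥`, and the projection `e` onto `𝔪'` satisfies `κ(e x, z) = tr(ad x ad z | 𝔪')`. In a
basis `y` of `𝔪` with Gram matrices `K` of `κ` and `K'` of the trace form of `𝔪'`, the matrix of `e`
is `K' K⁻¹`. So the rows of `K' adj(K)`, read as combinations of `y`, span `𝔪'`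
(`exists_spanning_of_gram`).

Everything is then a matter of size. Scaling a suitable dual basis of `𝔪` by a Plücker coordinate of
`v_M` turns all its entries into Plücker coordinates of `v_M`; this gives an integral basis `y` with
entries `O(ht(M))` (`exists_integral_basis`). The entries of `K` and `K'` are traces of `w ↦ [x, [y,
w]]` on invariant subspaces of the matrix space; they are integers of size `O(ht(M)²)`
(`trace_doubleBracket`). So `𝔪'` is spanned by integral matrices of size polynomial in `ht(M)`
(`exists_bounded_spanning`). The wedge of a basis chosen among them is a nonzero integral multiple
of `v_{M'}`, and its norm bounds `ht(M')` (`height_le_of_basis`).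

Nondegeneracy has to be extracted from the hypothesis on the group. If the complex Lie algebra has
nonzero radical, the last nonzero term of the derived series of that radical is an abelian ideal
stable under `Ad(M)`, even for disconnected `M`. The Zariski closure of its exponential is a closed,
connected, abelian, normal subgroup of `M`, hence trivial, and so the ideal is zero. An abelian
ideal over `ℚ` spans one over `ℂ` because the ideal of `M` has rational generators. The radical is
therefore also trivial over `ℚ`, and Cartan's criterion applies. -/

theorem hasDerivAt_eval {σ : Type} [Fintype σ] {c : ℂ → σ → ℂ} {c' : σ → ℂ} {t : ℂ}
    (h : ∀ i, HasDerivAt (fun s => c s i) (c' i) t) (p : MvPolynomial σ ℂ) :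
    HasDerivAt (fun s => eval (c s) p) (∑ i, eval (c t) (pderiv i p) * c' i) t := by
  classical
  induction p using MvPolynomial.induction_on with
  | C a => simpa using hasDerivAt_const t a
  | add p q hp hq =>
    simpa [add_mul, Finset.sum_add_distrib] using hp.fun_add hq
  | mul_X p i hp =>
    have := hp.mul (h i)
    simp only [map_mul, eval_X, Derivation.leibniz, smul_eq_mul, map_add, pderiv_X, add_mul,
      Finset.sum_add_distrib]
    refine this.congr_deriv ?_
    rw [add_comm, Finset.sum_mul]
    congr 1
    · rw [Finset.sum_eq_single i]
      · simp
      · intro j _ hj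
        simp [hj.symm]
      · simp
    · exact Finset.sum_congr rfl fun j _ => by ring

variable {N : ℕ}

/-- The entries of a complex matrix as a point of affine space. -/
def matEntries (A : Matrix (Fin N) (Fin N) ℂ) : Fin N × Fin N → ℂ := fun ij => A ij.1 ij.2

theorem entries_eq (g : SLN N) : entries g = matEntries g.1 := rfl

theorem mem_idealOf {A : Set (SLN N)} {p : EntryPoly N ℂ} :
    p ∈ idealOf A ↔ ∀ g ∈ A, eval (entries g) p = 0 := by
  simp [idealOf, mem_vanishingIdeal_iff]

theorem IsZariskiClosed.mem_of_forall {A : Set (SLN N)} (hA : IsZariskiClosed A) {g : SLN N}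
    (h : ∀ p ∈ idealOf A, eval (entries g) p = 0) : g ∈ A := by
  obtain ⟨S, rfl⟩ := hA
  intro p hp
  exact h p (mem_idealOf.mpr fun g hg => hg p hp)

/-- The complex tangent space of `M` at the identity. -/
def tangent (M : Subgroup (SLN N)) : Submodule ℂ (Matrix (Fin N) (Fin N) ℂ) where
  carrier := {X | ∀ p ∈ idealOf (M : Set (SLN N)),
    ∑ ij : Fin N × Fin N, eval (entries (1 : SLN N)) (pderiv ij p) * X ij.1 ij.2 = 0}
  zero_mem' := by intro p _; simp
  add_mem' := by
    intro X Y hX hY p hp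
    simpa [mul_add, Finset.sum_add_distrib] using congrArg₂ (· + ·) (hX p hp) (hY p hp)
  smul_mem' := by
    intro c X hX p hp
    have := congrArg (fun z => c * z) (hX p hp)
    simpa [Finset.mul_sum, mul_left_comm] using this

/-- The polynomial `A ↦ p (P A)` for a matrix `P` of polynomials. -/
def subst (P : Matrix (Fin N) (Fin N) (EntryPoly N ℂ)) (p : EntryPoly N ℂ) : EntryPoly N ℂ :=
  bind₁ (fun ij => P ij.1 ij.2) p

theorem eval_subst (P : Matrix (Fin N) (Fin N) (EntryPoly N ℂ)) (p : EntryPoly N ℂ)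
    (x : Fin N × Fin N → ℂ) :
    eval x (subst P p) = eval (matEntries (P.map (eval x))) p := by
  simp only [subst, ← coe_aeval_eq_eval, RingHom.coe_coe]
  rw [aeval_bind₁]
  rfl

/-- The generic matrix. -/
def genMat (N : ℕ) : Matrix (Fin N) (Fin N) (EntryPoly N ℂ) := Matrix.of fun i j => X (i, j)

theorem genMat_map_eval (A : Matrix (Fin N) (Fin N) ℂ) :
    (genMat N).map (eval (matEntries A)) = A := by
  ext i j; simp [genMat, matEntries]

theorem map_C_map_eval (A : Matrix (Fin N) (Fin N) ℂ) (x : Fin N × Fin N → ℂ) :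
    (A.map (C : ℂ →+* EntryPoly N ℂ)).map (eval x) = A := by
  ext i j; simp

/-- The polynomial `A ↦ p (g A h)`. -/
def translate (g h : Matrix (Fin N) (Fin N) ℂ) (p : EntryPoly N ℂ) : EntryPoly N ℂ :=
  subst (g.map (C : ℂ →+* EntryPoly N ℂ) * genMat N * h.map (C : ℂ →+* EntryPoly N ℂ)) p

theorem eval_translate (g h A : Matrix (Fin N) (Fin N) ℂ) (p : EntryPoly N ℂ) :
    eval (matEntries A) (translate g h p) = eval (matEntries (g * A * h)) p := by
  rw [translate, eval_subst, Matrix.map_mul, Matrix.map_mul, genMat_map_eval, map_C_map_eval,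
    map_C_map_eval]

theorem hasDerivAt_eval_matEntries {c : ℂ → Matrix (Fin N) (Fin N) ℂ}
    {c' : Matrix (Fin N) (Fin N) ℂ} {t : ℂ}
    (h : ∀ i j, HasDerivAt (fun s => c s i j) (c' i j) t) (p : EntryPoly N ℂ) :
    HasDerivAt (fun s => eval (matEntries (c s)) p)
      (∑ ij : Fin N × Fin N, eval (matEntries (c t)) (pderiv ij p) * c' ij.1 ij.2) t :=
  hasDerivAt_eval (c := fun s => matEntries (c s)) (c' := matEntries c')
    (fun ij => h ij.1 ij.2) p

theorem hasDerivAt_line (A X : Matrix (Fin N) (Fin N) ℂ) (t : ℂ) (i j : Fin N) :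
    HasDerivAt (fun s : ℂ => (A + s • X) i j) (X i j) t := by
  have := ((hasDerivAt_id t).mul_const (X i j)).const_add (A i j)
  simpa using this

/-- The chain rule for `A ↦ p (g A h)` at the identity. -/
theorem sum_pderiv_translate (g h X : Matrix (Fin N) (Fin N) ℂ) (p : EntryPoly N ℂ) :
    ∑ ij : Fin N × Fin N, eval (entries (1 : SLN N)) (pderiv ij (translate g h p)) * X ij.1 ij.2 =
      ∑ ij : Fin N × Fin N, eval (matEntries (g * h)) (pderiv ij p) * (g * X * h) ij.1 ij.2 := by
  have h1 := hasDerivAt_eval_matEntries (c := fun s => 1 + s • X) (c' := X) (t := 0)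
    (hasDerivAt_line 1 X 0) (translate g h p)
  have h2 := hasDerivAt_eval_matEntries (c := fun s => g * h + s • (g * X * h))
    (c' := g * X * h) (t := 0) (hasDerivAt_line (g * h) (g * X * h) 0) p
  have h3 : (fun s : ℂ => eval (matEntries (1 + s • X)) (translate g h p)) =
      fun s : ℂ => eval (matEntries (g * h + s • (g * X * h))) p := by
    funext s
    rw [eval_translate]
    simp [mul_add, add_mul]
  rw [h3] at h1
  have := h1.unique h2
  simpa [entries_eq] using this

/-! ### The exponential map and the tangent space -/

section Exponential

attribute [local instance] Matrix.linftyOpNormedRing Matrix.linftyOpNormedAlgebra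

variable {N : ℕ}

open NormedSpace

theorem hasDerivAt_entry_exp (X : Matrix (Fin N) (Fin N) ℂ) (t : ℂ) (i j : Fin N) :
    HasDerivAt (fun s : ℂ => exp (s • X) i j) ((exp (t • X) * X) i j) t :=
  (hasDerivAt_pi.mp (hasDerivAt_pi.mp (hasDerivAt_exp_smul_const X t) i)) j

theorem continuous_exp_matrix : Continuous (exp : Matrix (Fin N) (Fin N) ℂ → _) :=
  NormedSpace.exp_continuous

/-- The left-invariant vector field attached to the matrix `A`, as an operator on polynomials. -/
def invariantDeriv (A : Matrix (Fin N) (Fin N) ℂ) (p : EntryPoly N ℂ) : EntryPoly N ℂ :=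
  ∑ ij : Fin N × Fin N,
    pderiv ij p * (genMat N * A.map (C : ℂ →+* EntryPoly N ℂ)) ij.1 ij.2

theorem eval_invariantDeriv (A B : Matrix (Fin N) (Fin N) ℂ) (p : EntryPoly N ℂ) :
    eval (matEntries B) (invariantDeriv A p) =
      ∑ ij : Fin N × Fin N, eval (matEntries B) (pderiv ij p) * (B * A) ij.1 ij.2 := by
  have h : ((genMat N * A.map (C : ℂ →+* EntryPoly N ℂ))).map (eval (matEntries B)) = B * A := by
    rw [Matrix.map_mul, genMat_map_eval, map_C_map_eval]
  simp only [invariantDeriv, map_sum, map_mul]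
  refine Finset.sum_congr rfl fun ij _ => ?_
  rw [← h, Matrix.map_apply]

theorem translate_mem_idealOf {M : Subgroup (SLN N)} {g : SLN N} (hg : g ∈ M) {p : EntryPoly N ℂ}
    (hp : p ∈ idealOf (M : Set (SLN N))) : translate g.1 1 p ∈ idealOf (M : Set (SLN N)) := by
  rw [mem_idealOf] at hp ⊢
  intro h hh
  have := hp (g * h) (M.mul_mem hg hh)
  rw [entries_eq, Matrix.SpecialLinearGroup.coe_mul] at this
  rw [entries_eq, eval_translate, mul_one, this]

/-- The value at `g ∈ M` is the derivative at the identity, in the tangent direction `A`, of the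
left translate of `p` by `g`, which again vanishes on `M`. -/
theorem invariantDeriv_mem_idealOf {M : Subgroup (SLN N)} {A : Matrix (Fin N) (Fin N) ℂ}
    (hA : A ∈ tangent M) {p : EntryPoly N ℂ} (hp : p ∈ idealOf (M : Set (SLN N))) :
    invariantDeriv A p ∈ idealOf (M : Set (SLN N)) := by
  rw [mem_idealOf]
  intro g hg
  have := hA _ (translate_mem_idealOf hg hp)
  rw [sum_pderiv_translate, mul_one, mul_one] at this
  rw [entries_eq, eval_invariantDeriv, this]

theorem hasDerivAt_eval_exp (A : Matrix (Fin N) (Fin N) ℂ) (p : EntryPoly N ℂ) (t : ℂ) :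
    HasDerivAt (fun s : ℂ => eval (matEntries (exp (s • A))) p)
      (eval (matEntries (exp (t • A))) (invariantDeriv A p)) t := by
  rw [eval_invariantDeriv]
  exact hasDerivAt_eval_matEntries (fun i j => hasDerivAt_entry_exp A t i j) p

/-- Differentiating in `t` replaces `p` by its invariant derivative, which stays in the ideal of
`M`. So all Taylor coefficients at `0` of this entire function are values at the identity of
elements of the ideal, and they vanish. -/
theorem eval_exp_eq_zero {M : Subgroup (SLN N)} {A : Matrix (Fin N) (Fin N) ℂ}
    (hA : A ∈ tangent M) {p : EntryPoly N ℂ} (hp : p ∈ idealOf (M : Set (SLN N))) (t : ℂ) :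
    eval (matEntries (exp (t • A))) p = 0 := by
  have hiter : ∀ (n : ℕ) (q : EntryPoly N ℂ), q ∈ idealOf (M : Set (SLN N)) →
      iteratedDeriv n (fun s : ℂ => eval (matEntries (exp (s • A))) q) 0 = 0 := by
    intro n
    induction n with
    | zero =>
      intro q hq
      simpa [entries_eq] using mem_idealOf.mp hq 1 M.one_mem
    | succ n ih =>
      intro q hq
      rw [iteratedDeriv_succ']
      have : deriv (fun s : ℂ => eval (matEntries (exp (s • A))) q) =
          fun s : ℂ => eval (matEntries (exp (s • A))) (invariantDeriv A q) := by
        funext s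
        exact (hasDerivAt_eval_exp A q s).deriv
      rw [this]
      exact ih _ (invariantDeriv_mem_idealOf hA hq)
  have hd : Differentiable ℂ (fun s : ℂ => eval (matEntries (exp (s • A))) p) :=
    fun s => (hasDerivAt_eval_exp A p s).differentiableAt
  have h := Complex.taylorSeries_eq_of_entire' 0 t hd
  rw [← h]
  simp [hiter _ p hp]

/-- The polynomial `det - 1`. -/
def detSubOne (N : ℕ) : EntryPoly N ℂ := (genMat N).det - 1

theorem eval_detSubOne (A : Matrix (Fin N) (Fin N) ℂ) :
    eval (matEntries A) (detSubOne N) = A.det - 1 := by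
  rw [detSubOne, map_sub, map_one, RingHom.map_det, RingHom.mapMatrix_apply, genMat_map_eval]

theorem detSubOne_mem_idealOf (M : Set (SLN N)) : detSubOne N ∈ idealOf M := by
  rw [mem_idealOf]
  intro g _
  rw [entries_eq, eval_detSubOne, g.2, sub_self]

theorem exists_mem_eq_exp {M : Subgroup (SLN N)} (hM : IsZariskiClosed (M : Set (SLN N)))
    {A : Matrix (Fin N) (Fin N) ℂ} (hA : A ∈ tangent M) : ∃ g ∈ M, g.1 = exp A := by
  have hall : ∀ p ∈ idealOf (M : Set (SLN N)), eval (matEntries (exp A)) p = 0 := by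
    intro p hp
    simpa using eval_exp_eq_zero hA hp 1
  have hdet : (exp A).det = 1 := by
    have := hall _ (detSubOne_mem_idealOf _)
    rwa [eval_detSubOne, sub_eq_zero] at this
  exact ⟨⟨exp A, hdet⟩, hM.mem_of_forall hall, rfl⟩

theorem trace_eq_zero_of_mem_tangent {M : Subgroup (SLN N)} {A : Matrix (Fin N) (Fin N) ℂ}
    (hA : A ∈ tangent M) : A.trace = 0 := by
  have h1 := hasDerivAt_eval_matEntries (c := fun s => 1 + s • A) (c' := A) (t := 0)
    (hasDerivAt_line 1 A 0) (detSubOne N)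
  have h2 := hA _ (detSubOne_mem_idealOf _)
  simp only [zero_smul, add_zero] at h1
  rw [entries_eq, Matrix.SpecialLinearGroup.coe_one] at h2
  rw [h2] at h1
  -- The expansion `det(1 + sA) = 1 + s tr A + O(s²)` identifies the derivative of `det - 1` at the
  -- identity with the trace.
  have h3 : HasDerivAt (fun s : ℂ => 1 + A.trace * s +
      (Matrix.det (1 + (Polynomial.X : Polynomial ℂ) • A.map Polynomial.C)).divX.divX.eval s * s ^ 2
        - 1) A.trace 0 := by
    have hp := (Polynomial.hasDerivAt ((Matrix.det (1 + (Polynomial.X : Polynomial ℂ) •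
      A.map Polynomial.C)).divX.divX) 0).fun_mul (hasDerivAt_pow 2 (0 : ℂ))
    have hq := (((hasDerivAt_id (0 : ℂ)).const_mul A.trace).const_add 1).fun_add hp
    simpa using hq.sub_const 1
  refine h3.unique (h1.congr_of_eventuallyEq (Filter.Eventually.of_forall fun s => ?_))
  beta_reduce
  rw [eval_detSubOne, Matrix.det_one_add_smul s A]

/-- By normality, `p ↦ p(g · g⁻¹)` preserves the ideal of `M'`; the chain rule does the rest. -/
theorem conj_mem_tangent {M M' : Subgroup (SLN N)} (hle : M' ≤ M)
    (hn : (M'.subgroupOf M).Normal) {g : SLN N} (hg : g ∈ M) {A : Matrix (Fin N) (Fin N) ℂ}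
    (hA : A ∈ tangent M') : g.1 * A * (g⁻¹).1 ∈ tangent M' := by
  intro p hp
  have hmem : translate g.1 (g⁻¹).1 p ∈ idealOf (M' : Set (SLN N)) := by
    rw [mem_idealOf] at hp ⊢
    intro h hh
    rw [entries_eq, eval_translate]
    have := hn.conj_mem ⟨h, hle hh⟩ (by simpa [Subgroup.mem_subgroupOf] using hh) ⟨g, hg⟩
    exact hp (g * h * g⁻¹) (by simpa [Subgroup.mem_subgroupOf] using this)
  have := hA _ hmem
  rw [sum_pderiv_translate, ← Matrix.SpecialLinearGroup.coe_mul, mul_inv_cancel] at this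
  exact this

theorem hasDerivAt_conj_exp (A Y : Matrix (Fin N) (Fin N) ℂ) :
    HasDerivAt (fun s : ℂ => exp (s • A) * Y * exp (s • (-A))) (A * Y - Y * A) 0 := by
  have h1 := hasDerivAt_exp_smul_const A (0 : ℂ)
  have h2 := hasDerivAt_exp_smul_const (-A) (0 : ℂ)
  have := (h1.mul_const Y).mul h2
  refine this.congr_deriv ?_
  simp [sub_eq_add_neg]

/-- The curve `exp(sA) Y exp(-sA)` stays in the tangent space of `M'`, since `exp(sA)` lies in `M`.
A finite-dimensional subspace is closed, so it also contains the derivative `[A, Y]` at `0`. -/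
theorem lie_mem_tangent {M M' : Subgroup (SLN N)} (hM : IsZariskiClosed (M : Set (SLN N)))
    (hle : M' ≤ M) (hn : (M'.subgroupOf M).Normal) {A Y : Matrix (Fin N) (Fin N) ℂ}
    (hA : A ∈ tangent M) (hY : Y ∈ tangent M') : A * Y - Y * A ∈ tangent M' := by
  have hmem : ∀ s : ℂ, exp (s • A) * Y * exp (s • (-A)) ∈ tangent M' := by
    intro s
    obtain ⟨g, hg, hgA⟩ := exists_mem_eq_exp hM ((tangent M).smul_mem s hA)
    have hinv : (g⁻¹).1 = exp (s • (-A)) := by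
      have h1 : g.1 * (g⁻¹).1 = 1 := by
        rw [← Matrix.SpecialLinearGroup.coe_mul, mul_inv_cancel]; rfl
      rw [smul_neg, Matrix.exp_neg, ← hgA]
      exact (Matrix.inv_eq_right_inv h1).symm
    rw [← hgA, ← hinv]
    exact conj_mem_tangent hle hn hg hY
  have hclosed : IsClosed (tangent M' : Set (Matrix (Fin N) (Fin N) ℂ)) :=
    Submodule.closed_of_finiteDimensional _
  have hd := hasDerivAt_iff_tendsto_slope_zero.mp (hasDerivAt_conj_exp A Y)
  refine hclosed.mem_of_tendsto hd (Filter.Eventually.of_forall fun t => ?_)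
  refine (tangent M').smul_mem _ ((tangent M').sub_mem (hmem _) (hmem _))

theorem eq_zero_of_exp_smul_eq_one {A : Matrix (Fin N) (Fin N) ℂ}
    (h : ∀ t : ℂ, exp (t • A) = 1) : A = 0 := by
  ext i j
  have h1 := hasDerivAt_entry_exp A 0 i j
  simp only [h, one_mul] at h1
  exact h1.unique (hasDerivAt_const (0 : ℂ) _)

end Exponential

/-! ### Zariski closures -/

section ZariskiClosure

variable {N : ℕ}

/-- The Zariski closure of a subset of `SL_N(ℂ)`. -/
def zariskiClosure (A : Set (SLN N)) : Set (SLN N) :=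
  {g | ∀ p ∈ idealOf A, eval (entries g) p = 0}

theorem isZariskiClosed_zariskiClosure (A : Set (SLN N)) : IsZariskiClosed (zariskiClosure A) :=
  ⟨idealOf A, rfl⟩

theorem subset_zariskiClosure (A : Set (SLN N)) : A ⊆ zariskiClosure A :=
  fun g hg _ hp => mem_idealOf.mp hp g hg

theorem zariskiClosure_subset {A B : Set (SLN N)} (hB : IsZariskiClosed B) (h : A ⊆ B) :
    zariskiClosure A ⊆ B := fun _ hg =>
  hB.mem_of_forall fun p hp => hg p (mem_idealOf.mpr fun a ha => mem_idealOf.mp hp a (h ha))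

theorem IsZariskiClosed.preimage {A : Set (SLN N)} (hA : IsZariskiClosed A) {φ : SLN N → SLN N}
    (P : Matrix (Fin N) (Fin N) (EntryPoly N ℂ))
    (hP : ∀ g : SLN N, (φ g).1 = P.map (eval (entries g))) : IsZariskiClosed (φ ⁻¹' A) := by
  obtain ⟨S, rfl⟩ := hA
  refine ⟨subst P '' S, ?_⟩
  ext g
  simp only [Set.mem_preimage, Set.mem_ofPred_eq, Set.forall_mem_image, eval_subst, ← hP]
  rfl

theorem IsZariskiClosed.preimage_mul {A : Set (SLN N)} (hA : IsZariskiClosed A) (g h : SLN N) :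
    IsZariskiClosed ((fun x => g * x * h) ⁻¹' A) := by
  refine hA.preimage
    (g.1.map (C : ℂ →+* EntryPoly N ℂ) * genMat N * h.1.map (C : ℂ →+* EntryPoly N ℂ)) fun x => ?_
  rw [Matrix.map_mul, Matrix.map_mul, map_C_map_eval, map_C_map_eval, entries_eq, genMat_map_eval]
  rfl

/-- On `SL_N` the inverse is the adjugate, hence polynomial. -/
theorem IsZariskiClosed.preimage_inv {A : Set (SLN N)} (hA : IsZariskiClosed A) :
    IsZariskiClosed ((fun x => x⁻¹) ⁻¹' A) := by
  refine hA.preimage (genMat N).adjugate fun x => ?_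
  rw [← RingHom.mapMatrix_apply, RingHom.map_adjugate, RingHom.mapMatrix_apply, entries_eq,
    genMat_map_eval]
  rfl

theorem isZariskiClosed_commute (h : SLN N) : IsZariskiClosed {g : SLN N | g * h = h * g} := by
  refine ⟨Set.range fun ij : Fin N × Fin N =>
    (genMat N * h.1.map (C : ℂ →+* EntryPoly N ℂ) -
      h.1.map (C : ℂ →+* EntryPoly N ℂ) * genMat N) ij.1 ij.2, ?_⟩
  ext g
  have key : ((genMat N * h.1.map (C : ℂ →+* EntryPoly N ℂ) -
      h.1.map (C : ℂ →+* EntryPoly N ℂ) * genMat N)).map (eval (entries g)) =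
      g.1 * h.1 - h.1 * g.1 := by
    rw [Matrix.map_sub _ (by simp), Matrix.map_mul, Matrix.map_mul, map_C_map_eval, entries_eq,
      genMat_map_eval]
  simp only [Set.mem_ofPred_eq, Set.forall_mem_range]
  constructor
  · intro hgh ij
    have h2 := congrFun (congrFun key ij.1) ij.2
    rw [Matrix.map_apply] at h2
    rw [h2, ← Matrix.SpecialLinearGroup.coe_mul, ← Matrix.SpecialLinearGroup.coe_mul, hgh, sub_self]
    rfl
  · intro hgh
    apply Subtype.ext
    rw [Matrix.SpecialLinearGroup.coe_mul, Matrix.SpecialLinearGroup.coe_mul, ← sub_eq_zero, ← key]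
    ext i j
    exact hgh (i, j)

/-- The Zariski closure of a subgroup. -/
def closureSubgroup (H : Subgroup (SLN N)) : Subgroup (SLN N) where
  carrier := zariskiClosure (H : Set (SLN N))
  one_mem' := subset_zariskiClosure _ H.one_mem
  mul_mem' := by
    intro a b ha hb
    -- Closure is taken in one factor at a time: first with the left factor in `H`, then with the
    -- right factor fixed in the closure.
    have h1 : ∀ x ∈ H, ∀ y ∈ zariskiClosure (H : Set (SLN N)),
        x * y ∈ zariskiClosure (H : Set (SLN N)) := by
      intro x hx y hy
      have hc := (isZariskiClosed_zariskiClosure (H : Set (SLN N))).preimage_mul x 1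
      have := zariskiClosure_subset hc (fun z hz => by
        simpa using subset_zariskiClosure _ (H.mul_mem hx hz)) hy
      simpa using this
    have hc := (isZariskiClosed_zariskiClosure (H : Set (SLN N))).preimage_mul 1 b
    have := zariskiClosure_subset hc (fun z hz => by simpa using h1 z hz b hb) ha
    simpa using this
  inv_mem' := by
    intro a ha
    have hc := (isZariskiClosed_zariskiClosure (H : Set (SLN N))).preimage_inv
    exact zariskiClosure_subset hc (fun z hz => subset_zariskiClosure _ (H.inv_mem hz)) ha

theorem closureSubgroup_comm {H : Subgroup (SLN N)} (hH : ∀ x ∈ H, ∀ y ∈ H, x * y = y * x) :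
    ∀ x ∈ closureSubgroup H, ∀ y ∈ closureSubgroup H, x * y = y * x := by
  have h1 : ∀ x ∈ H, ∀ y ∈ closureSubgroup H, y * x = x * y := fun x hx y hy =>
    zariskiClosure_subset (isZariskiClosed_commute x) (fun z hz => hH z hz x hx) hy
  exact fun x hx y hy =>
    zariskiClosure_subset (isZariskiClosed_commute y) (fun z hz => (h1 z hz y hy).symm) hx

theorem conj_mem_closureSubgroup {H : Subgroup (SLN N)} {g : SLN N}
    (hg : ∀ x ∈ H, g * x * g⁻¹ ∈ H) {x : SLN N} (hx : x ∈ closureSubgroup H) :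
    g * x * g⁻¹ ∈ closureSubgroup H :=
  zariskiClosure_subset ((isZariskiClosed_zariskiClosure (H : Set (SLN N))).preimage_mul g g⁻¹)
    (fun z hz => subset_zariskiClosure _ (hg z hz)) hx

end ZariskiClosure

/-! ### Exponentials of abelian ideals and triviality of the radical -/

section AbelianIdeal

attribute [local instance] Matrix.linftyOpNormedRing Matrix.linftyOpNormedAlgebra

variable {N : ℕ}

open NormedSpace

/-- A matrix of determinant one as an element of `SL_N(ℂ)`. -/
def mkSL (A : Matrix (Fin N) (Fin N) ℂ) (h : A.det = 1) : SLN N := ⟨A, h⟩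

theorem mkSL_val (A : Matrix (Fin N) (Fin N) ℂ) (h : A.det = 1) : (mkSL A h).1 = A := rfl

/-- The image under the exponential map of a space of commuting matrices. -/
def expSubgroup (r : Submodule ℂ (Matrix (Fin N) (Fin N) ℂ))
    (hr : ∀ A ∈ r, ∀ B ∈ r, Commute A B) : Subgroup (SLN N) where
  carrier := {g | ∃ A ∈ r, g.1 = exp A}
  one_mem' := ⟨0, r.zero_mem, by simp⟩
  mul_mem' := by
    rintro a b ⟨A, hA, ha⟩ ⟨B, hB, hb⟩
    exact ⟨A + B, r.add_mem hA hB, by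
      rw [Matrix.exp_add_of_commute _ _ (hr A hA B hB), ← ha, ← hb]; rfl⟩
  inv_mem' := by
    rintro a ⟨A, hA, ha⟩
    refine ⟨-A, r.neg_mem hA, ?_⟩
    have h1 : a.1 * (a⁻¹).1 = 1 := by
      rw [← Matrix.SpecialLinearGroup.coe_mul, mul_inv_cancel]; rfl
    rw [Matrix.exp_neg, ← ha]
    exact (Matrix.inv_eq_right_inv h1).symm

theorem isClosed_setOf_eval_eq_zero (S : Set (EntryPoly N ℂ)) :
    IsClosed {A : Matrix (Fin N) (Fin N) ℂ | ∀ p ∈ S, eval (matEntries A) p = 0} := by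
  have : {A : Matrix (Fin N) (Fin N) ℂ | ∀ p ∈ S, eval (matEntries A) p = 0} =
      ⋂ p ∈ S, {A | eval (matEntries A) p = 0} := by ext; simp
  rw [this]
  refine isClosed_biInter fun p _ => isClosed_eq ?_ continuous_const
  refine (MvPolynomial.continuous_eval p).comp ?_
  exact continuous_pi fun ij => (continuous_apply ij.2).comp (continuous_apply ij.1)

/-- The space `r` is convex, hence connected, and the preimages under `exp` of Zariski closed sets
are closed in the usual topology. If neither of two such sets covering the closure contained all of
it, their preimages would both meet `r`, hence would meet each other inside `r`. -/
theorem isZariskiConnected_closure_exp (r : Submodule ℂ (Matrix (Fin N) (Fin N) ℂ))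
    (hr : ∀ A ∈ r, ∀ B ∈ r, Commute A B) (hdet : ∀ A ∈ r, (exp A).det = 1) :
    IsZariskiConnected (closureSubgroup (expSubgroup r hr) : Set (SLN N)) := by
  intro A B hA hB hAB hdisj
  have hsub : ∀ {D : Set (SLN N)}, IsZariskiClosed D → (∀ X ∈ r, ∀ g : SLN N, g.1 = exp X → g ∈ D) →
      (closureSubgroup (expSubgroup r hr) : Set (SLN N)) ⊆ D := by
    intro D hD h
    exact zariskiClosure_subset hD (by rintro g ⟨X, hX, hg⟩; exact h X hX g hg)
  have hA' := hA
  have hB' := hB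
  obtain ⟨S, rfl⟩ := hA'
  obtain ⟨T, rfl⟩ := hB'
  have hconn : IsPreconnected (r : Set (Matrix (Fin N) (Fin N) ℂ)) :=
    (r.restrictScalars ℝ).convex.isPreconnected
  rw [isPreconnected_closed_iff] at hconn
  have hmem : ∀ X (hX : X ∈ r), mkSL (exp X) (hdet X hX) ∈
      (closureSubgroup (expSubgroup r hr) : Set (SLN N)) := fun X hX =>
    subset_zariskiClosure _ ⟨X, hX, rfl⟩
  have hor : ∀ X ∈ r, (∀ p ∈ S, eval (matEntries (exp X)) p = 0) ∨
      ∀ p ∈ T, eval (matEntries (exp X)) p = 0 := by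
    intro X hX
    simpa only [Set.mem_union, Set.mem_ofPred_eq, entries_eq, mkSL_val] using hAB (hmem X hX)
  have hcl := hconn (exp ⁻¹' {A | ∀ p ∈ S, eval (matEntries A) p = 0})
    (exp ⁻¹' {A | ∀ p ∈ T, eval (matEntries A) p = 0})
    ((isClosed_setOf_eval_eq_zero S).preimage continuous_exp_matrix)
    ((isClosed_setOf_eval_eq_zero T).preimage continuous_exp_matrix) hor
  by_contra hcon
  rw [not_or] at hcon
  have hex : ∀ {U : Set (EntryPoly N ℂ)},
      ¬ (closureSubgroup (expSubgroup r hr) : Set (SLN N)) ⊆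
        {g | ∀ p ∈ U, eval (entries g) p = 0} →
      ∃ X ∈ r, ¬ ∀ p ∈ U, eval (matEntries (exp X)) p = 0 := by
    intro U hU
    by_contra hno
    refine hU (hsub ⟨U, rfl⟩ fun X hX g hg p hp => ?_)
    rw [entries_eq, hg]
    by_contra hne
    exact hno ⟨X, hX, fun hall => hne (hall p hp)⟩
  obtain ⟨X, hX, hXS⟩ := hex hcon.1
  obtain ⟨Y, hY, hYT⟩ := hex hcon.2
  obtain ⟨Z, hZ, hZ1, hZ2⟩ := hcl ⟨Y, hY, (hor Y hY).resolve_right hYT⟩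
    ⟨X, hX, (hor X hX).resolve_left hXS⟩
  have : mkSL (exp Z) (hdet Z hZ) ∈ (∅ : Set (SLN N)) := by
    rw [← hdisj]
    refine ⟨hmem Z hZ, ?_, ?_⟩
    · simpa only [Set.mem_preimage, Set.mem_ofPred_eq, entries_eq, mkSL_val] using hZ1
    · simpa only [Set.mem_preimage, Set.mem_ofPred_eq, entries_eq, mkSL_val] using hZ2
  exact this

/-- The Zariski closure of `exp(r)` is commutative, connected, and normal in `M`, so it is trivial
by semisimplicity. Then `exp(tA) = 1` for all `t` and `A ∈ r`, which forces `A = 0`. Stability under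
conjugation by all of `M` is assumed, because `M` may be disconnected. -/
theorem eq_bot_of_isSemisimpleGroup {M : Subgroup (SLN N)}
    (hM : IsZariskiClosed (M : Set (SLN N))) (hss : IsSemisimpleGroup M)
    (r : Submodule ℂ (Matrix (Fin N) (Fin N) ℂ)) (hrM : r ≤ tangent M)
    (hr : ∀ A ∈ r, ∀ B ∈ r, Commute A B)
    (hconj : ∀ g ∈ M, ∀ A ∈ r, g.1 * A * (g⁻¹).1 ∈ r) : r = ⊥ := by
  have hexp : ∀ A ∈ r, ∃ g ∈ M, g.1 = exp A := fun A hA => exists_mem_eq_exp hM (hrM hA)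
  have hdet : ∀ A ∈ r, (exp A).det = 1 := by
    intro A hA
    obtain ⟨g, -, hg⟩ := hexp A hA
    rw [← hg, g.2]
  have hHM : (expSubgroup r hr : Set (SLN N)) ⊆ M := by
    rintro g ⟨A, hA, hg⟩
    obtain ⟨g', hg', hgA⟩ := hexp A hA
    have : g = g' := Subtype.ext (hg.trans hgA.symm)
    rwa [this]
  have hcomm := closureSubgroup_comm (H := expSubgroup r hr) (by
    rintro x ⟨A, hA, hx⟩ y ⟨B, hB, hy⟩
    apply Subtype.ext
    rw [Matrix.SpecialLinearGroup.coe_mul, Matrix.SpecialLinearGroup.coe_mul, hx, hy,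
      ← Matrix.exp_add_of_commute _ _ (hr A hA B hB),
      ← Matrix.exp_add_of_commute _ _ (hr B hB A hA), add_comm])
  have hbot := hss (closureSubgroup (expSubgroup r hr)) (zariskiClosure_subset hM hHM)
    ⟨fun x hx g => by
      rw [Subgroup.mem_subgroupOf] at hx ⊢
      refine conj_mem_closureSubgroup ?_ hx
      rintro y ⟨A, hA, hy⟩
      refine ⟨_, hconj g.1 g.2 A hA, ?_⟩
      have hu : g.1.1 * (g.1⁻¹).1 = 1 := by
        rw [← Matrix.SpecialLinearGroup.coe_mul, mul_inv_cancel]; rfl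
      have hu' : (g.1⁻¹).1 = (g.1.1)⁻¹ := (Matrix.inv_eq_right_inv hu).symm
      rw [hu', Matrix.exp_conj _ _ ⟨⟨g.1.1, (g.1⁻¹).1, hu, by
        rw [← Matrix.SpecialLinearGroup.coe_mul, inv_mul_cancel]; rfl⟩, rfl⟩, ← hy, ← hu']
      rfl⟩
    (isZariskiClosed_zariskiClosure _) (isZariskiConnected_closure_exp r hr hdet)
    (by
      have : ∀ a b : closureSubgroup (expSubgroup r hr), a * b = b * a := fun a b =>
        Subtype.ext (hcomm a.1 a.2 b.1 b.2)
      exact Group.isSolvable_of_comm this)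
  rw [eq_bot_iff]
  intro A hA
  refine (Submodule.mem_bot ℂ).mpr (eq_zero_of_exp_smul_eq_one fun t => ?_)
  have h1 : mkSL (exp (t • A)) (hdet _ (r.smul_mem t hA)) ∈
      closureSubgroup (expSubgroup r hr) :=
    subset_zariskiClosure _ ⟨t • A, r.smul_mem t hA, rfl⟩
  rw [hbot, Subgroup.mem_bot] at h1
  exact congrArg Subtype.val h1

end AbelianIdeal

/-! ### Characteristic abelian ideals -/

section Characteristic

variable {K L : Type*} [CommRing K] [LieRing L] [LieAlgebra K L]

theorem derivedSeriesOfIdeal_map_equiv (e : L ≃ₗ⁅K⁆ L) (I : LieIdeal K L) (k : ℕ) :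
    LieAlgebra.derivedSeriesOfIdeal K L k (LieIdeal.map e.toLieHom I) =
      LieIdeal.map e.toLieHom (LieAlgebra.derivedSeriesOfIdeal K L k I) := by
  induction k with
  | zero => simp
  | succ k ih =>
    rw [LieAlgebra.derivedSeriesOfIdeal_succ, LieAlgebra.derivedSeriesOfIdeal_succ, ih,
      LieIdeal.map_bracket_eq e.toLieHom e.surjective]

theorem radical_map_equiv_le [IsNoetherian K L] (e : L ≃ₗ⁅K⁆ L) :
    LieIdeal.map e.toLieHom (LieAlgebra.radical K L) ≤ LieAlgebra.radical K L := by
  rw [← LieAlgebra.LieIdeal.solvable_iff_le_radical]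
  obtain ⟨k, hk⟩ := LieAlgebra.IsSolvable.solvable K (LieAlgebra.radical K L)
  rw [LieIdeal.derivedSeries_eq_bot_iff] at hk
  refine LieAlgebra.IsSolvable.mk (R := K) (k := k) ?_
  rw [LieIdeal.derivedSeries_eq_bot_iff, derivedSeriesOfIdeal_map_equiv, hk]
  exact (LieIdeal.map_eq_bot_iff).mpr bot_le

/-- If the radical is nonzero, then there is a nonzero abelian ideal that is stable under all
automorphisms. -/
theorem exists_characteristic_abelian [IsNoetherian K L] (h : LieAlgebra.radical K L ≠ ⊥) :
    ∃ I : LieIdeal K L, I ≠ ⊥ ∧ IsLieAbelian I ∧ ∀ e : L ≃ₗ⁅K⁆ L, ∀ x ∈ I, e x ∈ I := by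
  refine ⟨LieAlgebra.derivedAbelianOfIdeal (LieAlgebra.radical K L), ?_,
    LieAlgebra.abelian_derivedAbelianOfIdeal _, ?_⟩
  · rwa [Ne, LieAlgebra.abelian_of_solvable_ideal_eq_bot_iff]
  · intro e x hx
    -- The ideal is the last nonzero term of the derived series of the radical. Automorphisms
    -- preserve the radical and hence every term of this series.
    unfold LieAlgebra.derivedAbelianOfIdeal at hx ⊢
    split at hx
    · simp only [LieSubmodule.mem_bot] at hx ⊢
      rw [hx, map_zero]
    · rename_i k _
      have h1 := LieAlgebra.derivedSeriesOfIdeal_mono (radical_map_equiv_le e) k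
      rw [derivedSeriesOfIdeal_map_equiv] at h1
      exact h1 (LieIdeal.mem_map hx)

end Characteristic

/-! ### The Lie algebra of a semisimple group -/

section LieAlgebraOfGroup

attribute [local instance 100] LieRing.ofAssociativeRing

variable {N : ℕ}

theorem subgroupOf_self_normal (M : Subgroup (SLN N)) : (M.subgroupOf M).Normal := by
  rw [Subgroup.subgroupOf_self]; infer_instance

/-- The complex Lie algebra of an algebraic subgroup. -/
def complexLie (M : Subgroup (SLN N)) (hM : IsZariskiClosed (M : Set (SLN N))) :
    LieSubalgebra ℂ (Matrix (Fin N) (Fin N) ℂ) :=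
  { tangent M with
    lie_mem' := fun hx hy => lie_mem_tangent hM le_rfl (subgroupOf_self_normal M) hx hy }

/-- The adjoint action of `g ∈ M` on the complex Lie algebra of `M`. -/
def adjointEquiv (M : Subgroup (SLN N)) (hM : IsZariskiClosed (M : Set (SLN N))) (g : SLN N)
    (hg : g ∈ M) : complexLie M hM ≃ₗ⁅ℂ⁆ complexLie M hM where
  toFun A := ⟨g.1 * A.1 * (g⁻¹).1, conj_mem_tangent le_rfl (subgroupOf_self_normal M) hg A.2⟩
  map_add' A B := Subtype.ext (by simp [mul_add, add_mul])
  map_smul' c A := Subtype.ext (by simp)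
  map_lie' := by
    intro A B
    have h : (g⁻¹).1 * g.1 = 1 := by
      rw [← Matrix.SpecialLinearGroup.coe_mul, inv_mul_cancel]; rfl
    apply Subtype.ext
    have key : ∀ X Y : Matrix (Fin N) (Fin N) ℂ,
        g.1 * (X * Y) * (g⁻¹).1 = (g.1 * X * (g⁻¹).1) * (g.1 * Y * (g⁻¹).1) := by
      intro X Y
      calc g.1 * (X * Y) * (g⁻¹).1 = g.1 * X * 1 * Y * (g⁻¹).1 := by
            simp only [mul_one, mul_assoc]
        _ = _ := by rw [← h]; simp only [mul_assoc]
    change g.1 * (A.1 * B.1 - B.1 * A.1) * (g⁻¹).1 = _ * _ - _ * _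
    rw [mul_sub, sub_mul, key, key]
  invFun A := ⟨(g⁻¹).1 * A.1 * g.1, by
    have := conj_mem_tangent le_rfl (subgroupOf_self_normal M) (M.inv_mem hg) A.2
    rwa [inv_inv] at this⟩
  left_inv A := by
    have h : (g⁻¹).1 * g.1 = 1 := by
      rw [← Matrix.SpecialLinearGroup.coe_mul, inv_mul_cancel]; rfl
    apply Subtype.ext
    change (g⁻¹).1 * (g.1 * A.1 * (g⁻¹).1) * g.1 = A.1
    calc _ = ((g⁻¹).1 * g.1) * A.1 * ((g⁻¹).1 * g.1) := by simp only [mul_assoc]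
      _ = A.1 := by rw [h, one_mul, mul_one]
  right_inv A := by
    have h : g.1 * (g⁻¹).1 = 1 := by
      rw [← Matrix.SpecialLinearGroup.coe_mul, mul_inv_cancel]; rfl
    apply Subtype.ext
    change g.1 * ((g⁻¹).1 * A.1 * g.1) * (g⁻¹).1 = A.1
    calc _ = (g.1 * (g⁻¹).1) * A.1 * (g.1 * (g⁻¹).1) := by simp only [mul_assoc]
      _ = A.1 := by rw [h, one_mul, mul_one]

theorem hasTrivialRadical_complexLie {M : Subgroup (SLN N)}
    (hM : IsZariskiClosed (M : Set (SLN N))) (hss : IsSemisimpleGroup M) :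
    LieAlgebra.HasTrivialRadical ℂ (complexLie M hM) := by
  rw [LieAlgebra.hasTrivialRadical_iff]
  by_contra hrad
  obtain ⟨I, hI, hab, hchar⟩ := exists_characteristic_abelian hrad
  have hbot := eq_bot_of_isSemisimpleGroup hM hss
    (Submodule.map (complexLie M hM).toSubmodule.subtype I.toSubmodule)
    (by rintro _ ⟨A, -, rfl⟩; exact A.2)
    (by
      rintro _ ⟨A, hA, rfl⟩ _ ⟨B, hB, rfl⟩
      have h0 : ⁅(⟨A, hA⟩ : I), (⟨B, hB⟩ : I)⁆ = 0 := hab.trivial _ _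
      have h1 : A.1 * B.1 - B.1 * A.1 = 0 :=
        congrArg (fun z : I => (z.1.1 : Matrix (Fin N) (Fin N) ℂ)) h0
      exact sub_eq_zero.mp h1)
    (by
      rintro g hg _ ⟨A, hA, rfl⟩
      exact ⟨_, hchar (adjointEquiv M hM g hg) A hA, rfl⟩)
  apply hI
  rw [LieSubmodule.eq_bot_iff]
  intro A hA
  have : A.1 ∈ (⊥ : Submodule ℂ (Matrix (Fin N) (Fin N) ℂ)) := by
    rw [← hbot]; exact ⟨A, hA, rfl⟩
  exact Subtype.ext this

/-- A rational traceless matrix as a complex matrix. -/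
def ratMat (A : sl (Fin N) ℚ) : Matrix (Fin N) (Fin N) ℂ := A.1.map (Rat.cast : ℚ → ℂ)

theorem mem_lieAlg_iff {M : Subgroup (SLN N)} {A : sl (Fin N) ℚ} :
    A ∈ lieAlg M ↔ ratMat A ∈ tangent M := Iff.rfl

theorem ratMat_lie (A B : sl (Fin N) ℚ) :
    ratMat ⁅A, B⁆ = ratMat A * ratMat B - ratMat B * ratMat A := by
  rw [ratMat, sl_bracket]
  ext i j
  simp [ratMat, Matrix.mul_apply]

theorem ratMat_injective : Function.Injective (ratMat : sl (Fin N) ℚ → _) := by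
  intro A B h
  ext i j
  have := congrFun (congrFun h i) j
  simpa [ratMat] using this

theorem lie_mem_lieAlg {M M' : Subgroup (SLN N)} (hM : IsZariskiClosed (M : Set (SLN N)))
    (hle : M' ≤ M) (hn : (M'.subgroupOf M).Normal) {A B : sl (Fin N) ℚ}
    (hA : A ∈ lieAlg M) (hB : B ∈ lieAlg M') : ⁅A, B⁆ ∈ lieAlg M' := by
  rw [mem_lieAlg_iff] at hA hB ⊢
  rw [ratMat_lie]
  exact lie_mem_tangent hM hle hn hA hB

theorem lieAlg_mono {M M' : Subgroup (SLN N)} (hle : M' ≤ M) : lieAlg M' ≤ lieAlg M :=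
  fun _ hA p hp => hA p (mem_idealOf.mpr fun g hg => mem_idealOf.mp hp g (hle hg))

/-- The Lie algebra of `M`, as a Lie subalgebra of `sl_N(ℚ)`. -/
def rationalLie (M : Subgroup (SLN N)) (hM : IsZariskiClosed (M : Set (SLN N))) :
    LieSubalgebra ℚ (sl (Fin N) ℚ) :=
  { lieAlg M with
    lie_mem' := fun hx hy => lie_mem_lieAlg hM le_rfl (subgroupOf_self_normal M) hx hy }

/-- If the ideal of `M` is generated by rational polynomials, then the complex tangent space is
spanned by its rational points. -/
theorem tangent_le_span {M : Subgroup (SLN N)} (hM : IsQSubgroup M) :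
    tangent M ≤ Submodule.span ℂ (ratMat '' (lieAlg M : Set (sl (Fin N) ℚ))) := by
  classical
  intro A hA
  obtain ⟨-, S, hS⟩ := hM
  -- The entries of `A` are expanded in a basis of `ℂ` over `ℚ`. The tangent equations of the
  -- rational generators have rational coefficients, so each coefficient matrix `c k` satisfies them
  -- separately.
  let b := Module.Basis.ofVectorSpace ℚ ℂ
  let c : Module.Basis.ofVectorSpaceIndex ℚ ℂ → Matrix (Fin N) (Fin N) ℚ :=
    fun k => Matrix.of fun i j => b.repr (A i j) k
  have hc : ∀ k, (c k).map (Rat.cast : ℚ → ℂ) ∈ tangent M := by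
    intro k p hp
    rw [hS] at hp
    have hker : ∀ q ∈ S, ∑ ij : Fin N × Fin N,
        eval (entries (1 : SLN N)) (pderiv ij (MvPolynomial.map (algebraMap ℚ ℂ) q)) *
          ((c k).map (Rat.cast : ℚ → ℂ)) ij.1 ij.2 = 0 := by
      intro q hq
      have hq' := hA (MvPolynomial.map (algebraMap ℚ ℂ) q)
        (by rw [hS]; exact Ideal.subset_span ⟨q, hq, rfl⟩)
      let e : Fin N × Fin N → ℚ := fun ij => (1 : Matrix (Fin N) (Fin N) ℚ) ij.1 ij.2
      have he : (fun ij => algebraMap ℚ ℂ (e ij)) = entries (1 : SLN N) := by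
        funext ij
        simp [e, entries, Matrix.one_apply]
      have hev : ∀ ij, eval (entries (1 : SLN N)) (pderiv ij (MvPolynomial.map (algebraMap ℚ ℂ) q))
          = ((eval e (pderiv ij q) : ℚ) : ℂ) := by
        intro ij
        rw [pderiv_map, ← he, eval_map]
        exact (eval₂_comp (algebraMap ℚ ℂ) e _).symm
      simp only [hev] at hq' ⊢
      have h2 := congrArg (fun z => b.repr z k) hq'
      simp only [map_sum, ← Rat.smul_def, map_smul, Finsupp.coe_finsetSum, Finset.sum_apply,
        Finsupp.smul_apply, smul_eq_mul, map_zero, Finsupp.zero_apply] at h2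
      simp only [Matrix.map_apply, c, Matrix.of_apply]
      exact_mod_cast h2
    clear hA
    induction hp using Submodule.span_induction with
    | mem q hq => obtain ⟨q, hq, rfl⟩ := hq; exact hker q hq
    | zero => simp
    | add p q _ _ hp hq =>
      simpa [add_mul, Finset.sum_add_distrib] using congrArg₂ (· + ·) hp hq
    | smul a p hp' hp =>
      -- Since `p` vanishes at the identity, the Leibniz rule makes the equation of `a * p` a
      -- multiple of that of `p`.
      have h0 : eval (entries (1 : SLN N)) p = 0 := by
        have : p ∈ idealOf (M : Set (SLN N)) := by rw [hS]; exact hp'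
        exact mem_idealOf.mp this 1 M.one_mem
      simp only [smul_eq_mul, Derivation.leibniz, map_add, map_mul, h0, zero_mul, add_zero,
        mul_assoc, ← Finset.mul_sum, hp, mul_zero]
  have htr : ∀ k, (c k).trace = 0 := by
    intro k
    have := trace_eq_zero_of_mem_tangent (hc k)
    rw [Matrix.trace] at this ⊢
    simp only [Matrix.diag_apply, Matrix.map_apply] at this ⊢
    exact_mod_cast this
  let X : Module.Basis.ofVectorSpaceIndex ℚ ℂ → sl (Fin N) ℚ :=
    fun k => ⟨c k, LinearMap.mem_ker.mpr (htr k)⟩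
  let s : Finset (Module.Basis.ofVectorSpaceIndex ℚ ℂ) :=
    Finset.univ.biUnion fun ij : Fin N × Fin N => (b.repr (A ij.1 ij.2)).support
  have hsum : A = ∑ k ∈ s, b k • ratMat (X k) := by
    ext i j
    rw [Matrix.sum_apply]
    conv_lhs => rw [← b.linearCombination_repr (A i j), Finsupp.linearCombination_apply]
    rw [Finsupp.sum_of_support_subset (s := s) _ (fun k hk => Finset.mem_biUnion.mpr
      ⟨(i, j), Finset.mem_univ _, hk⟩) _ (by simp)]
    refine Finset.sum_congr rfl fun k _ => ?_
    simp [ratMat, X, c, Rat.smul_def, mul_comm]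
  rw [hsum]
  exact Submodule.sum_mem _ fun k _ => Submodule.smul_mem _ _
    (Submodule.subset_span ⟨X k, hc k, rfl⟩)

/-- The complex span of a rational abelian ideal is an abelian ideal of the complex Lie algebra: the
bracket is bilinear, and by `tangent_le_span` it suffices to bracket with rational elements. Over
`ℂ` such an ideal vanishes. -/
theorem hasTrivialRadical_rationalLie {M : Subgroup (SLN N)} (hM : IsQSubgroup M)
    (hss : IsSemisimpleGroup M) : LieAlgebra.HasTrivialRadical ℚ (rationalLie M hM.1) := by
  rw [LieAlgebra.hasTrivialRadical_iff_no_abelian_ideals]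
  intro I hab
  have htriv := hasTrivialRadical_complexLie hM.1 hss
  let S : Set (Matrix (Fin N) (Fin N) ℂ) := (fun A : rationalLie M hM.1 => ratMat A.1) '' I
  have hlie : ∀ A ∈ tangent M, ∀ B ∈ Submodule.span ℂ S, A * B - B * A ∈ Submodule.span ℂ S := by
    intro A hA B hB
    have hA' := tangent_le_span hM hA
    clear hA
    induction hA' using Submodule.span_induction with
    | zero => simp
    | add A A' _ _ h h' =>
      have := Submodule.add_mem _ h h'
      rwa [show A * B - B * A + (A' * B - B * A') = (A + A') * B - B * (A + A') by noncomm_ring]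
        at this
    | smul c A _ h =>
      have := Submodule.smul_mem _ c h
      rwa [smul_sub, ← smul_mul_assoc, ← mul_smul_comm] at this
    | mem A hA =>
      obtain ⟨A, hA, rfl⟩ := hA
      induction hB using Submodule.span_induction with
      | zero => simp
      | add B B' _ _ h h' =>
        have := Submodule.add_mem _ h h'
        rwa [show ratMat A * B - B * ratMat A + (ratMat A * B' - B' * ratMat A) =
          ratMat A * (B + B') - (B + B') * ratMat A by noncomm_ring] at this
      | smul c B _ h =>
        have := Submodule.smul_mem _ c h
        rwa [smul_sub, ← mul_smul_comm, ← smul_mul_assoc] at this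
      | mem B hB =>
        obtain ⟨B, hB, rfl⟩ := hB
        refine Submodule.subset_span ⟨⁅(⟨A, hA⟩ : rationalLie M hM.1), B⁆,
          LieSubmodule.lie_mem I hB, ?_⟩
        exact ratMat_lie A B.1
  have hcomm : ∀ A ∈ Submodule.span ℂ S, ∀ B ∈ Submodule.span ℂ S, Commute A B := by
    intro A hA B hB
    induction hA using Submodule.span_induction with
    | zero => exact Commute.zero_left _
    | add A A' _ _ h h' => exact h.add_left h'
    | smul c A _ h => exact h.smul_left c
    | mem A hA =>
      induction hB using Submodule.span_induction with
      | zero => exact Commute.zero_right _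
      | add A A' _ _ h h' => exact h.add_right h'
      | smul c A _ h => exact h.smul_right c
      | mem B hB =>
        obtain ⟨A, hA, rfl⟩ := hA
        obtain ⟨B, hB, rfl⟩ := hB
        have h0 : ⁅(⟨A, hA⟩ : I), (⟨B, hB⟩ : I)⁆ = 0 := hab.trivial _ _
        have h1 : ⁅A.1, B.1⁆ = 0 := congrArg (fun z : I => (z.1.1 : sl (Fin N) ℚ)) h0
        have h2 := ratMat_lie A.1 B.1
        rw [h1, eq_comm, show ratMat (0 : sl (Fin N) ℚ) = 0 by ext; simp [ratMat]] at h2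
        exact sub_eq_zero.mp h2
  let J : LieIdeal ℂ (complexLie M hM.1) :=
    { Submodule.comap (complexLie M hM.1).toSubmodule.subtype (Submodule.span ℂ S) with
      lie_mem := fun {A B} hB => hlie A.1 A.2 B.1 hB }
  have hJ : J = ⊥ := by
    refine (LieAlgebra.hasTrivialRadical_iff_no_abelian_ideals ℂ _).mp htriv J ⟨fun A B => ?_⟩
    exact Subtype.ext (Subtype.ext (sub_eq_zero.mpr (hcomm _ A.2 _ B.2)))
  rw [LieSubmodule.eq_bot_iff] at hJ ⊢
  intro A hA
  have h1 := hJ ⟨ratMat A.1, A.2⟩ (Submodule.subset_span ⟨A, hA, rfl⟩)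
  have h2 : ratMat A.1 = 0 := congrArg Subtype.val h1
  apply Subtype.ext
  apply ratMat_injective
  rw [h2]
  ext; simp [ratMat]

/-- This is Cartan's criterion in characteristic zero. -/
theorem isKilling_rationalLie {M : Subgroup (SLN N)} (hM : IsQSubgroup M)
    (hss : IsSemisimpleGroup M) : LieAlgebra.IsKilling ℚ (rationalLie M hM.1) := by
  have := hasTrivialRadical_rationalLie hM hss
  infer_instance

end LieAlgebraOfGroup

/-! ### Bases adapted to a family of coordinates -/

section Auerbach

variable {K W ι : Type*} [Field K] [LinearOrder K] [IsStrictOrderedRing K] [AddCommGroup W]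
  [Module K W] [Finite ι]

/-- The matrix of the functionals `φ (J l)` in the basis `b`. -/
def minorMatrix {d : ℕ} (b : Fin d → W) (φ : ι → Module.Dual K W) (J : Fin d → ι) :
    Matrix (Fin d) (Fin d) K := Matrix.of fun k l => φ (J l) (b k)

/-- As the functionals separate points, the value vectors of the basis are linearly independent
rows. Row rank equals column rank, so some `d` columns are independent. -/
theorem exists_det_minorMatrix_ne_zero {K W ι : Type*} [Field K] [AddCommGroup W] [Module K W]
    {d : ℕ} (b : Module.Basis (Fin d) K W) (φ : ι → Module.Dual K W)
    (hφ : ∀ w, (∀ i, φ i w = 0) → w = 0) : ∃ J, (minorMatrix b φ J).det ≠ 0 := by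
  let f : Fin d → ι → K := fun k i => φ i (b k)
  have hf : LinearIndependent K f := by
    rw [Fintype.linearIndependent_iff]
    intro g hg
    have hw : ∑ k, g k • b k = 0 := hφ _ fun i => by
      simpa [f] using congrFun hg i
    exact Fintype.linearIndependent_iff.mp b.linearIndependent g hw
  have hspan := span_flip_eq_top_iff_linearIndependent.mpr hf
  obtain ⟨κ, a, -, ha, hli⟩ := exists_linearIndependent' K (flip f)
  rw [hspan] at ha
  let B := Module.Basis.mk hli (by rw [ha])
  have : Finite κ := Module.Finite.finite_basis B
  have : Fintype κ := Fintype.ofFinite κ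
  have hcard : Fintype.card κ = d := by
    have := Module.finrank_eq_card_basis B
    simpa using this.symm
  let e := (Fintype.equivFinOfCardEq hcard).symm
  refine ⟨fun l => a (e l), fun hdet => ?_⟩
  obtain ⟨v, hv, hv0⟩ := Matrix.exists_mulVec_eq_zero_iff.mpr hdet
  have hli' : LinearIndependent K ((flip f ∘ a) ∘ e) := hli.comp _ e.injective
  rw [Fintype.linearIndependent_iff] at hli'
  refine hv (funext fun l => hli' v ?_ l)
  funext k
  have := congrFun hv0 k
  simp only [Matrix.mulVec, dotProduct, minorMatrix, Matrix.of_apply, Pi.zero_apply] at this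
  simpa [flip, f, mul_comm] using this

/-- A finite-dimensional space with a finite separating family of functionals has a basis that is
dual to some of the functionals, and on which all functionals are bounded by one. -/
theorem exists_auerbach_basis {d : ℕ} (b : Module.Basis (Fin d) K W) (φ : ι → Module.Dual K W)
    (hφ : ∀ w, (∀ i, φ i w = 0) → w = 0) :
    ∃ (w : Module.Basis (Fin d) K W) (J : Fin d → ι),
      (∀ l x, w.repr x l = φ (J l) x) ∧ ∀ i l, |φ i (w l)| ≤ 1 := by
  classical
  obtain ⟨J₀, hJ₀⟩ := exists_det_minorMatrix_ne_zero b φ hφ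
  have : Nonempty (Fin d → ι) := ⟨J₀⟩
  -- The choice of `J` maximises the minor, and `w` is the basis dual to the functionals `φ (J l)`.
  -- By Cramer's rule, `φ i (w l)` is the minor with `J l` replaced by `i`, divided by the maximal
  -- one, so it is at most `1` in absolute value.
  obtain ⟨J, hJ⟩ := Finite.exists_max fun J : Fin d → ι => |(minorMatrix b φ J).det|
  set A := minorMatrix b φ J with hA
  have hdet : A.det ≠ 0 := fun h => hJ₀ (by
    have := hJ J₀
    rw [h, abs_zero] at this
    exact abs_eq_zero.mp (le_antisymm this (abs_nonneg _)))
  have hunit : IsUnit A.det := isUnit_iff_ne_zero.mpr hdet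
  let w : Fin d → W := fun l => ∑ k, A⁻¹ l k • b k
  have hφw : ∀ i l, φ i (w l) = (A⁻¹.mulVec fun k => φ i (b k)) l := by
    intro i l
    simp [w, Matrix.mulVec, dotProduct]
  have hdual : ∀ l m, φ (J m) (w l) = (1 : Matrix (Fin d) (Fin d) K) l m := by
    intro l m
    rw [← Matrix.nonsing_inv_mul A hunit, hφw]
    rfl
  have hli : LinearIndependent K w := by
    rw [Fintype.linearIndependent_iff]
    intro g hg m
    have := congrArg (φ (J m)) hg
    simpa [hdual, Matrix.one_apply] using this
  have hcard : Fintype.card (Fin d) = Module.finrank K W := (Module.finrank_eq_card_basis b).symm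
  have hfin : FiniteDimensional K W := Module.Basis.finiteDimensional_of_finite b
  let w' : Module.Basis (Fin d) K W := basisOfLinearIndependentOfCardEqFinrank' w hli hcard
  have hw' : ∀ l, w' l = w l := fun l => by simp [w']
  refine ⟨w', J, fun l x => ?_, fun i l => ?_⟩
  · conv_rhs => rw [← w'.sum_repr x]
    simp [hw', hdual, Matrix.one_apply]
  · rw [hw', hφw]
    have hcr : A.det * (A⁻¹.mulVec fun k => φ i (b k)) l =
        (minorMatrix b φ (Function.update J l i)).det := by
      have h1 : (minorMatrix b φ (Function.update J l i)) = A.updateCol l fun k => φ i (b k) := by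
        ext k m
        by_cases hm : m = l
        · subst hm; simp [minorMatrix]
        · simp [minorMatrix, hA, hm]
      rw [h1, ← Matrix.cramer_apply, Matrix.cramer_eq_adjugate_mulVec, Matrix.inv_def,
        Ring.inverse_eq_inv', Matrix.smul_mulVec, Pi.smul_apply, smul_eq_mul, ← mul_assoc,
        mul_inv_cancel₀ hdet, one_mul]
    have h2 := hJ (Function.update J l i)
    rw [← hcr, abs_mul] at h2
    have h3 : 0 < |A.det| := abs_pos.mpr hdet
    exact le_of_mul_le_mul_left (by simpa using h2) h3

end Auerbach

/-! ### Traces of integral operators -/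

section Trace

/-- Over an algebraic closure the trace is the sum of the eigenvalues, and each eigenvalue is a root
of the monic integral polynomial that annihilates `A`. -/
theorem isIntegral_matrix_trace {n : Type*} [Fintype n] [DecidableEq n] (A : Matrix n n ℚ)
    (hA : IsIntegral ℤ A) : IsIntegral ℤ A.trace := by
  let F := AlgebraicClosure ℚ
  have hinj : Function.Injective (algebraMap ℚ F) := (algebraMap ℚ F).injective
  rw [← isIntegral_algebraMap_iff (R := ℤ) hinj]
  let A' : Matrix n n F := A.map (algebraMap ℚ F)
  have htr : algebraMap ℚ F A.trace = A'.trace := by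
    simp [A', Matrix.trace]
  have hA' : IsIntegral ℤ A' := by
    have := hA.map ((Algebra.ofId ℚ F).mapMatrix (m := n)).toIntAlgHom
    exact this
  rw [htr, Matrix.trace_eq_sum_roots_charpoly]
  refine IsIntegral.multiset_sum fun μ hμ => ?_
  obtain ⟨P, hP, hPA⟩ := hA'
  refine ⟨P, hP, ?_⟩
  have hroot : A'.charpoly.IsRoot μ := (Polynomial.mem_roots'.mp hμ).2
  have hev : Module.End.HasEigenvalue (Matrix.toLin' A') μ := by
    rw [Module.End.hasEigenvalue_iff_isRoot_charpoly]
    simpa using hroot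
  obtain ⟨v, hv⟩ := hev.exists_hasEigenvector
  have h1 := Module.End.aeval_apply_of_hasEigenvector (p := P.map (algebraMap ℤ F)) hv
  have h2 : Polynomial.aeval (Matrix.toLin' A') (P.map (algebraMap ℤ F)) = 0 := by
    have h3 : Polynomial.aeval A' (P.map (algebraMap ℤ F)) = 0 := by
      rw [Polynomial.aeval_map_algebraMap]; exact hPA
    have h4 := Polynomial.aeval_algHom_apply (Matrix.toLinAlgEquiv' (R := F) (n := n)).toAlgHom A'
      (P.map (algebraMap ℤ F))
    rw [h3, map_zero] at h4
    exact h4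
  rw [h2, LinearMap.zero_apply, eq_comm, smul_eq_zero] at h1
  rw [← Polynomial.eval_map]
  exact h1.resolve_right hv.2

/-- A monic polynomial annihilating `S` annihilates `T`, as `f` is injective. Integrality thus
passes to invariant subspaces without a choice of a lattice in them. -/
theorem isIntegral_of_intertwine {W V : Type*} [AddCommGroup W] [Module ℚ W] [AddCommGroup V]
    [Module ℚ V] (f : W →ₗ[ℚ] V) (hf : Function.Injective f) (T : Module.End ℚ W)
    (S : Module.End ℚ V) (h : ∀ w, f (T w) = S (f w)) (hS : IsIntegral ℤ S) : IsIntegral ℤ T := by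
  obtain ⟨P, hP, hPS⟩ := hS
  refine ⟨P, hP, ?_⟩
  have key : ∀ Q : Polynomial ℤ, ∀ w,
      f (Polynomial.aeval T Q w) = Polynomial.aeval S Q (f w) := by
    intro Q
    induction Q using Polynomial.induction_on' with
    | add p q hp hq => intro w; simp [hp, hq]
    | monomial n a =>
      intro w
      have hpow : ∀ n : ℕ, ∀ w, f ((T ^ n) w) = (S ^ n) (f w) := by
        intro n
        induction n with
        | zero => intro w; simp
        | succ n ih => intro w; rw [pow_succ, pow_succ, Module.End.mul_apply, ih, h]; rfl
      simp only [Polynomial.aeval_monomial, Module.End.mul_apply, ← hpow, Algebra.algebraMap_eq_smul_one,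
        LinearMap.smul_apply, Module.End.one_apply, map_zsmul]
  refine LinearMap.ext fun w => hf ?_
  have := key P w
  rw [Polynomial.aeval_def, Polynomial.aeval_def, hPS] at this
  rw [this]
  simp

/-- All entries of the rational matrix `A` are integers. -/
def IsIntMat {N : ℕ} (A : Matrix (Fin N) (Fin N) ℚ) : Prop := ∀ i j, ∃ n : ℤ, A i j = n

variable {N : ℕ}

theorem IsIntMat.mul {A B : Matrix (Fin N) (Fin N) ℚ} (hA : IsIntMat A) (hB : IsIntMat B) :
    IsIntMat (A * B) := by
  intro i j
  choose a ha using hA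
  choose b hb using hB
  exact ⟨∑ k, a i k * b k j, by simp [Matrix.mul_apply, ha, hb]⟩

theorem IsIntMat.sub {A B : Matrix (Fin N) (Fin N) ℚ} (hA : IsIntMat A) (hB : IsIntMat B) :
    IsIntMat (A - B) := by
  intro i j
  obtain ⟨a, ha⟩ := hA i j
  obtain ⟨b, hb⟩ := hB i j
  exact ⟨a - b, by simp [ha, hb]⟩

theorem isIntegral_of_preserves (S : Module.End ℚ (Matrix (Fin N) (Fin N) ℚ))
    (hS : ∀ A, IsIntMat A → IsIntMat (S A)) : IsIntegral ℤ S := by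
  classical
  let b := Matrix.stdBasis ℚ (Fin N) (Fin N)
  have hint : ∀ p q, ∃ n : ℤ, LinearMap.toMatrix b b S p q = n := by
    intro p q
    rw [LinearMap.toMatrix_apply]
    have h1 : IsIntMat (b q) := by
      intro i j
      rw [Matrix.stdBasis_eq_single]
      rw [Matrix.single_apply]
      split
      · exact ⟨1, by simp⟩
      · exact ⟨0, by simp⟩
    exact hS _ h1 p.1 p.2
  choose A hA using hint
  let A' : Matrix (Fin N × Fin N) (Fin N × Fin N) ℤ := Matrix.of A
  have h1 : IsIntegral ℤ A' := Algebra.IsIntegral.isIntegral A'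
  have h2 := h1.map ((Algebra.ofId ℤ ℚ).mapMatrix (m := Fin N × Fin N))
  have h3 : (Algebra.ofId ℤ ℚ).mapMatrix A' = LinearMap.toMatrixAlgEquiv b S := by
    ext p q
    rw [LinearMap.toMatrixAlgEquiv_apply', ← LinearMap.toMatrix_apply', hA]
    rfl
  rw [h3] at h2
  have h4 := h2.map ((LinearMap.toMatrixAlgEquiv b).symm.toAlgHom.restrictScalars ℤ)
  simpa using h4

/-- The operator `w ↦ [x, [y, w]]` on matrices. -/
def doubleBracket (x y : Matrix (Fin N) (Fin N) ℚ) : Module.End ℚ (Matrix (Fin N) (Fin N) ℚ) where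
  toFun w := x * (y * w - w * y) - (y * w - w * y) * x
  map_add' a b := by noncomm_ring
  map_smul' c a := by
    simp only [RingHom.id_apply, mul_smul_comm, smul_mul_assoc, smul_sub, mul_sub, sub_mul]

theorem doubleBracket_apply (x y w : Matrix (Fin N) (Fin N) ℚ) :
    doubleBracket x y w = x * (y * w - w * y) - (y * w - w * y) * x := rfl

theorem abs_commutator_le {x w : Matrix (Fin N) (Fin N) ℚ} {H c : ℚ}
    (hx : ∀ i j, |x i j| ≤ H) (hw : ∀ i j, |w i j| ≤ c) (i j : Fin N) :
    |(x * w - w * x) i j| ≤ 2 * N * H * c := by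
  have hH : 0 ≤ H := (abs_nonneg _).trans (hx i j)
  have key : ∀ {p q : Matrix (Fin N) (Fin N) ℚ} {a b : ℚ}, 0 ≤ a → (∀ i j, |p i j| ≤ a) →
      (∀ i j, |q i j| ≤ b) → |(p * q) i j| ≤ N * (a * b) := by
    intro p q a b ha hp hq
    rw [Matrix.mul_apply]
    refine (Finset.abs_sum_le_sum_abs _ _).trans ?_
    refine (Finset.sum_le_sum (g := fun _ => a * b) fun k _ => ?_).trans (by simp)
    rw [abs_mul]
    exact mul_le_mul (hp _ _) (hq _ _) (abs_nonneg _) ha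
  have hc : 0 ≤ c := (abs_nonneg _).trans (hw i j)
  rw [Matrix.sub_apply]
  have := abs_sub ((x * w) i j) ((w * x) i j)
  linarith [key hH hx hw, key hc hw hx]

/-- The trace of `w ↦ [x, [y, w]]` on an invariant subspace is an integer, and bounded, if `x` and
`y` are integral and bounded. -/
theorem trace_doubleBracket {W : Type*} [AddCommGroup W] [Module ℚ W] [FiniteDimensional ℚ W]
    (f : W →ₗ[ℚ] Matrix (Fin N) (Fin N) ℚ) (hf : Function.Injective f) (T : Module.End ℚ W)
    {x y : Matrix (Fin N) (Fin N) ℚ} (hx : IsIntMat x) (hy : IsIntMat y) {H : ℚ}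
    (hxH : ∀ i j, |x i j| ≤ H) (hyH : ∀ i j, |y i j| ≤ H)
    (hT : ∀ w, f (T w) = doubleBracket x y (f w)) :
    (∃ n : ℤ, LinearMap.trace ℚ W T = n) ∧ |LinearMap.trace ℚ W T| ≤ 4 * N ^ 4 * H ^ 2 := by
  classical
  let φ : Fin N × Fin N → Module.Dual ℚ W := fun ij =>
    (LinearMap.proj ij.2 ∘ₗ LinearMap.proj ij.1) ∘ₗ
      (f : W →ₗ[ℚ] (Fin N → Fin N → ℚ))
  have hφ' : ∀ ij w, φ ij w = f w ij.1 ij.2 := fun _ _ => rfl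
  -- In this basis the coordinates are matrix entries and the basis vectors have entries at most
  -- `1`. Each diagonal coefficient of `T` is then an entry of `[x, [y, w l]]`, bounded by `(2NH)²`,
  -- and there are at most `N²` of them.
  obtain ⟨w, J, hrepr, hle⟩ := exists_auerbach_basis (Module.finBasis ℚ W) φ (by
    intro w hw
    refine hf ?_
    ext i j
    simpa [hφ'] using hw (i, j))
  constructor
  · have hS : IsIntegral ℤ (doubleBracket x y) := isIntegral_of_preserves _ fun A hA =>
      (hx.mul ((hy.mul hA).sub (hA.mul hy))).sub (((hy.mul hA).sub (hA.mul hy)).mul hx)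
    have hTi := isIntegral_of_intertwine f hf T _ hT hS
    have h2 : IsIntegral ℤ (LinearMap.toMatrixAlgEquiv w T) :=
      hTi.map ((LinearMap.toMatrixAlgEquiv w).toAlgHom.restrictScalars ℤ)
    have h3 := isIntegral_matrix_trace _ h2
    have h4 : (LinearMap.toMatrixAlgEquiv w T).trace = LinearMap.trace ℚ W T :=
      (LinearMap.trace_eq_matrix_trace ℚ w T).symm
    rw [h4] at h3
    obtain ⟨n, hn⟩ := IsIntegrallyClosed.isIntegral_iff.mp h3
    exact ⟨n, by rw [← hn]; simp⟩
  · rw [LinearMap.trace_eq_matrix_trace ℚ w T, Matrix.trace]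
    refine (Finset.abs_sum_le_sum_abs _ _).trans ?_
    have hd : Module.finrank ℚ W ≤ N ^ 2 := by
      have := LinearMap.finrank_le_finrank_of_injective hf
      simpa [Module.finrank_matrix, sq] using this
    have hterm : ∀ l, |(LinearMap.toMatrix w w T).diag l| ≤ 4 * N ^ 2 * H ^ 2 := by
      intro l
      rw [Matrix.diag_apply, LinearMap.toMatrix_apply, hrepr, hφ', hT, doubleBracket_apply]
      refine (abs_commutator_le hxH
        (abs_commutator_le hyH (fun i j => hle (i, j) l)) _ _).trans (le_of_eq ?_)
      ring
    refine (Finset.sum_le_sum fun l _ => hterm l).trans ?_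
    rw [Finset.sum_const, Finset.card_univ, Fintype.card_fin, nsmul_eq_mul]
    have hd' : (Module.finrank ℚ W : ℚ) ≤ N ^ 2 := by exact_mod_cast hd
    calc (Module.finrank ℚ W : ℚ) * (4 * N ^ 2 * H ^ 2) ≤ N ^ 2 * (4 * N ^ 2 * H ^ 2) := by
          gcongr
      _ = _ := by ring

end Trace

/-! ### Projections onto ideals -/

section IdealProjection

variable {L : Type*} [LieRing L] [LieAlgebra ℚ L] [FiniteDimensional ℚ L]

/-- The projection onto an ideal of a Lie algebra with nondegenerate Killing form is determined by
the trace form of the ideal. -/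
theorem exists_ideal_projection [LieAlgebra.IsKilling ℚ L] (I : LieIdeal ℚ L) :
    ∃ e : L →ₗ[ℚ] L, (∀ x, e x ∈ I) ∧ (∀ x ∈ I, e x = x) ∧
      ∀ x z, killingForm ℚ L (e x) z = LieModule.traceForm ℚ L I x z := by
  have hc : IsCompl I I.killingCompl := LieIdeal.isCompl_killingCompl I
  have hc' : IsCompl I.toSubmodule I.killingCompl.toSubmodule :=
    LieSubmodule.isCompl_toSubmodule.mpr hc
  -- For `a ∈ I` the operator `ad z ∘ ad a` maps into `I`, so its traces on `L` and on `I` agree.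
  have hI : ∀ a ∈ I, ∀ z, killingForm ℚ L a z = LieModule.traceForm ℚ L I a z := by
    intro a ha z
    rw [LieModule.traceForm_comm, LieModule.traceForm_comm ℚ L I]
    have h := LinearMap.trace_restrict_eq_of_forall_mem I.toSubmodule
      (LieModule.toEnd ℚ L L z ∘ₗ LieModule.toEnd ℚ L L a)
      (fun m => I.lie_mem (lie_mem_left ℚ L I a m ha))
    rw [LieModule.traceForm_apply_apply, ← h, LieModule.traceForm_apply_apply]
    rfl
  -- An element of the complement acts as zero on `I`, since the brackets lie in `I ⊓ I.killingCompl
  -- = ⊥`.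
  have hperp : ∀ b ∈ I.killingCompl, ∀ z, LieModule.traceForm ℚ L I b z = 0 := by
    intro b hb z
    rw [LieModule.traceForm_apply_apply]
    have h0 : LieModule.toEnd ℚ L I b = 0 := by
      ext m
      have h1 : ⁅b, m.1⁆ ∈ I ⊓ I.killingCompl :=
        ⟨I.lie_mem m.2, lie_mem_left ℚ L I.killingCompl b m.1 hb⟩
      rw [hc.inf_eq_bot, LieSubmodule.mem_bot] at h1
      exact h1
    rw [h0, LinearMap.zero_comp, map_zero]
  let P := Submodule.projection _ _ hc'
  have hPI : ∀ x, P x ∈ I := Submodule.projection_apply_mem hc'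
  refine ⟨P, hPI, fun x hx => Submodule.projection_apply_left hc' ⟨x, hx⟩, fun x z => ?_⟩
  have hx : x = P x + (x - P x) := by abel
  have hmem : x - P x ∈ I.killingCompl := Submodule.sub_projection_mem hc' x
  rw [hI _ (hPI x)]
  conv_rhs => rw [hx, map_add, LinearMap.add_apply, hperp _ hmem, add_zero]

/-- A multiple of the projection onto an ideal, in terms of Gram matrices of trace forms. -/
theorem exists_spanning_of_gram [LieAlgebra.IsKilling ℚ L] (I : LieIdeal ℚ L) {d : ℕ}
    (y : Module.Basis (Fin d) ℚ L) (K K' : Matrix (Fin d) (Fin d) ℚ)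
    (hK : ∀ l k, K l k = killingForm ℚ L (y l) (y k))
    (hK' : ∀ l k, K' l k = LieModule.traceForm ℚ L I (y l) (y k)) :
    Submodule.span ℚ (Set.range fun l => ∑ j, (K' * K.adjugate) l j • y j) = I.toSubmodule := by
  classical
  obtain ⟨e, heI, heid, he⟩ := exists_ideal_projection I
  have hdet : K.det ≠ 0 := by
    have h1 := (LinearMap.BilinForm.nondegenerate_iff_det_ne_zero (B := killingForm ℚ L) y).mp
      (LieAlgebra.IsKilling.killingForm_nondegenerate ℚ L)
    have h2 : LinearMap.BilinForm.toMatrix y (killingForm ℚ L) = K := by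
      ext l k
      rw [LinearMap.BilinForm.toMatrix_apply, hK]
    rwa [h2] at h1
  let A : Matrix (Fin d) (Fin d) ℚ := Matrix.of fun l j => y.repr (e (y l)) j
  have hAe : ∀ l, e (y l) = ∑ j, A l j • y j := fun l => (y.sum_repr _).symm
  have hAK : A * K = K' := by
    ext l k
    rw [hK', ← he, hAe, Matrix.mul_apply, map_sum, LinearMap.sum_apply]
    simp [hK]
  -- From `A K = K'` one gets `K' adj(K) = det(K) A`, which clears the denominators of the
  -- projection without changing the span of the rows.
  have hz : ∀ l, ∑ j, (K' * K.adjugate) l j • y j = K.det • e (y l) := by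
    intro l
    rw [← hAK, mul_assoc, Matrix.mul_adjugate, hAe, Finset.smul_sum]
    refine Finset.sum_congr rfl fun j _ => ?_
    simp [smul_smul]
  simp only [hz]
  apply le_antisymm
  · rw [Submodule.span_le]
    rintro _ ⟨l, rfl⟩
    exact I.toSubmodule.smul_mem _ (heI _)
  · intro x hx
    have h1 : x = ∑ l, (y.repr x l * K.det⁻¹) • K.det • e (y l) := by
      conv_lhs => rw [← heid x hx, ← y.sum_repr x, map_sum]
      refine Finset.sum_congr rfl fun l _ => ?_
      rw [map_smul, smul_smul, mul_assoc, inv_mul_cancel₀ hdet, mul_one]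
    rw [h1]
    exact Submodule.sum_mem _ fun l _ => Submodule.smul_mem _ _ (Submodule.subset_span ⟨l, rfl⟩)

end IdealProjection

/-! ### Bounded integral vectors in the Lie algebra of a normal subgroup -/

section Bounds

attribute [local instance 100] LieRing.ofAssociativeRing

theorem abs_mul_adjugate_le {d : ℕ} (K K' : Matrix (Fin d) (Fin d) ℚ) {β : ℚ} (hβ : 1 ≤ β)
    (hK : ∀ i j, |K i j| ≤ β) (hK' : ∀ i j, |K' i j| ≤ β) (i j : Fin d) :
    |(K' * K.adjugate) i j| ≤ d * (β * (d.factorial * β ^ d)) := by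
  have hadj : ∀ i j, |K.adjugate i j| ≤ d.factorial * β ^ d := by
    intro i j
    rw [Matrix.adjugate_apply]
    -- An entry of the adjugate is the determinant of `K` with a row replaced by a unit vector; this
    -- is why `1 ≤ β` is needed.
    have := Matrix.det_le (A := K.updateRow j (Pi.single i 1)) (abv := AbsoluteValue.abs) (x := β)
      (by
        intro k l
        rw [Matrix.updateRow_apply]
        split
        · rw [Pi.single_apply]
          split
          · simpa using hβ
          · simpa using zero_le_one.trans hβ
        · exact hK k l)
    simpa using this
  rw [Matrix.mul_apply]
  refine (Finset.abs_sum_le_sum_abs _ _).trans ?_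
  refine (Finset.sum_le_sum (g := fun _ => β * (d.factorial * β ^ d)) fun k _ => ?_).trans
    (by simp)
  rw [abs_mul]
  exact mul_le_mul (hK' _ _) (hadj _ _) (abs_nonneg _) (by linarith)

variable {N : ℕ}

/-- The vectors are the combinations of `y` given by the rows of `K' adj(K)`. In the bound, the
outer `d` counts the basis vectors and `H` bounds their entries; the inner factor, with `β = (4N⁴ +
1)H²`, bounds an entry of `K' adj(K)`. -/
theorem exists_bounded_spanning {M M' : Subgroup (SLN N)} (hM : IsQSubgroup M)
    (hss : IsSemisimpleGroup M) (hle : M' ≤ M) (hn : (M'.subgroupOf M).Normal) {d : ℕ}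
    (y : Module.Basis (Fin d) ℚ (lieAlg M)) {H : ℚ} (hH : 1 ≤ H)
    (hy : ∀ l, IsIntMat (y l).1.1) (hyH : ∀ l i j, |(y l).1.1 i j| ≤ H) :
    ∃ z : Fin d → sl (Fin N) ℚ, Submodule.span ℚ (Set.range z) = lieAlg M' ∧
      (∀ l, IsIntMat (z l).1) ∧ ∀ l i j, |(z l).1 i j| ≤
        d * (d * ((4 * N ^ 4 + 1) * H ^ 2 * (d.factorial * ((4 * N ^ 4 + 1) * H ^ 2) ^ d)) * H) := by
  classical
  have hkil := isKilling_rationalLie hM hss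
  let L := rationalLie M hM.1
  let y' : Module.Basis (Fin d) ℚ L := y
  have hy' : ∀ l, (y' l).1 = (y l).1 := fun _ => rfl
  let I : LieIdeal ℚ L :=
    { Submodule.comap L.toSubmodule.subtype (lieAlg M') with
      lie_mem := fun {A B} hB => lie_mem_lieAlg hM.1 hle hn A.2 hB }
  have hmemI : ∀ x : L, x ∈ I ↔ x.1 ∈ lieAlg M' := fun _ => Iff.rfl
  let incl : sl (Fin N) ℚ →ₗ[ℚ] Matrix (Fin N) (Fin N) ℚ := (sl (Fin N) ℚ).toSubmodule.subtype
  let fL : L →ₗ[ℚ] Matrix (Fin N) (Fin N) ℚ := incl ∘ₗ L.toSubmodule.subtype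
  have hfL : Function.Injective fL := Subtype.val_injective.comp Subtype.val_injective
  let fI : I →ₗ[ℚ] Matrix (Fin N) (Fin N) ℚ := fL ∘ₗ I.toSubmodule.subtype
  have hfI : Function.Injective fI := hfL.comp Subtype.val_injective
  have hbr : ∀ x z w : L, fL ⁅x, ⁅z, w⁆⁆ = doubleBracket (fL x) (fL z) (fL w) := fun _ _ _ => rfl
  have hKall : ∀ l k, (∃ n : ℤ, killingForm ℚ L (y' l) (y' k) = n) ∧
      |killingForm ℚ L (y' l) (y' k)| ≤ 4 * N ^ 4 * H ^ 2 := fun l k =>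
    trace_doubleBracket fL hfL _ (hy l) (hy k) (hyH l) (hyH k) fun w => hbr (y' l) (y' k) w
  have hK'all : ∀ l k, (∃ n : ℤ, LieModule.traceForm ℚ L I (y' l) (y' k) = n) ∧
      |LieModule.traceForm ℚ L I (y' l) (y' k)| ≤ 4 * N ^ 4 * H ^ 2 := fun l k =>
    trace_doubleBracket fI hfI _ (hy l) (hy k) (hyH l) (hyH k) fun w => hbr (y' l) (y' k) w.1
  choose Kz hKz using fun l k => (hKall l k).1
  choose Kz' hKz' using fun l k => (hK'all l k).1
  let K : Matrix (Fin d) (Fin d) ℚ := (Matrix.of Kz).map (Int.castRingHom ℚ)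
  let K' : Matrix (Fin d) (Fin d) ℚ := (Matrix.of Kz').map (Int.castRingHom ℚ)
  have hKeq : ∀ l k, K l k = killingForm ℚ L (y' l) (y' k) := fun l k => (hKz l k).symm
  have hKeq' : ∀ l k, K' l k = LieModule.traceForm ℚ L I (y' l) (y' k) :=
    fun l k => (hKz' l k).symm
  have hspan := exists_spanning_of_gram I y' K K' hKeq hKeq'
  have hint : K' * K.adjugate =
      (Matrix.of Kz' * (Matrix.of Kz).adjugate).map (Int.castRingHom ℚ) := by
    rw [Matrix.map_mul]
    congr 1
    exact ((Int.castRingHom ℚ).map_adjugate (Matrix.of Kz)).symm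
  -- The summand `1` keeps `β ≥ 1` even for `N = 0`.
  set β : ℚ := (4 * N ^ 4 + 1) * H ^ 2 with hβ
  have hH2 : 1 ≤ H ^ 2 := one_le_pow₀ hH
  have hβ' : 4 * (N : ℚ) ^ 4 * H ^ 2 ≤ β := by
    rw [hβ, add_mul]; linarith
  have hβ1 : 1 ≤ β := by
    have : 0 ≤ 4 * (N : ℚ) ^ 4 * H ^ 2 := by positivity
    rw [hβ, add_mul]; linarith
  have hA := abs_mul_adjugate_le K K' hβ1
    (fun l k => by rw [hKeq]; exact (hKall l k).2.trans hβ')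
    (fun l k => by rw [hKeq']; exact (hK'all l k).2.trans hβ')
  have hzval : ∀ l i j, (∑ k, (K' * K.adjugate) l k • (y k).1 : sl (Fin N) ℚ).1 i j =
      ∑ k, (K' * K.adjugate) l k * (y k).1.1 i j := by
    intro l i j
    have h1 : (∑ k, (K' * K.adjugate) l k • (y k).1 : sl (Fin N) ℚ).1 =
        ∑ k, (K' * K.adjugate) l k • (y k).1.1 := by
      change incl _ = _
      rw [map_sum]
      rfl
    rw [h1, Matrix.sum_apply]
    rfl
  refine ⟨fun l => ∑ k, (K' * K.adjugate) l k • (y k).1, ?_, ?_, ?_⟩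
  · have h1 := congrArg (Submodule.map L.toSubmodule.subtype) hspan
    rw [Submodule.map_span, ← Set.range_comp] at h1
    have h2 : Submodule.map L.toSubmodule.subtype I.toSubmodule = lieAlg M' := by
      ext x
      constructor
      · rintro ⟨w, hw, rfl⟩
        exact hw
      · intro hx
        exact ⟨⟨x, lieAlg_mono hle hx⟩, hx, rfl⟩
    rw [h2] at h1
    rw [← h1]
    congr 2
    funext l
    simp only [Function.comp_apply, map_sum, map_smul]
    rfl
  · intro l i j
    choose n hn using fun k => hy k i j
    refine ⟨∑ k, (Matrix.of Kz' * (Matrix.of Kz).adjugate) l k * n k, ?_⟩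
    rw [hzval, hint]
    simp [hn]
  · intro l i j
    rw [hzval]
    refine (Finset.abs_sum_le_sum_abs _ _).trans ?_
    refine (Finset.sum_le_sum fun k _ => ?_).trans (by
      rw [Finset.sum_const, Finset.card_univ, Fintype.card_fin, nsmul_eq_mul])
    rw [abs_mul]
    exact mul_le_mul (hA l k) (hyH k i j) (abs_nonneg _) ((abs_nonneg _).trans (hA l k))

end Bounds

/-! ### The Euclidean norm on exterior powers -/

section Euclidean

variable {V : Type} [AddCommGroup V] [Module ℝ V]

/-- Orthonormality is phrased as an equality of functionals, so that it carries over directly to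
exterior powers through the dual pairing. -/
theorem exists_orthonormal_basis [FiniteDimensional ℝ V] {B : V →ₗ[ℝ] V →ₗ[ℝ] ℝ} (hB : IsInnerProduct B) :
    ∃ b : Module.Basis (Fin (Module.finrank ℝ V)) ℝ V, ∀ i, B (b i) = b.coord i := by
  obtain ⟨v, hv⟩ := LinearMap.BilinForm.exists_orthogonal_basis (B := B) ⟨hB.1⟩
  have hpos : ∀ i, 0 < B (v i) (v i) := fun i => hB.2 _ (v.ne_zero i)
  have hsq : ∀ i, √(B (v i) (v i)) ≠ 0 := fun i => (Real.sqrt_pos.mpr (hpos i)).ne'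
  have hunit : ∀ i, IsUnit (√(B (v i) (v i)))⁻¹ := fun i =>
    isUnit_iff_ne_zero.mpr (inv_ne_zero (hsq i))
  refine ⟨v.isUnitSMul hunit, fun i => (v.isUnitSMul hunit).ext fun j => ?_⟩
  rw [Module.Basis.coord_apply, Module.Basis.repr_self, Module.Basis.isUnitSMul_apply,
    Module.Basis.isUnitSMul_apply, map_smul, map_smul, LinearMap.smul_apply, smul_eq_mul,
    smul_eq_mul]
  by_cases hij : j = i
  · subst hij
    rw [Finsupp.single_eq_same]
    have h1 : B (v j) (v j) = √(B (v j) (v j)) * √(B (v j) (v j)) :=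
      (Real.mul_self_sqrt (hpos j).le).symm
    have h2 := hsq j
    generalize √(B (v j) (v j)) = s at h1 h2
    rw [h1]
    field_simp
  · have h0 : B (v i) (v j) = 0 := hv (Ne.symm hij)
    rw [h0, Finsupp.single_eq_of_ne (Ne.symm hij)]
    simp

theorem wedgeForm_ιMulti (B : V →ₗ[ℝ] V →ₗ[ℝ] ℝ) {d : ℕ} (x y : Fin d → V) :
    wedgeForm B d (exteriorPower.ιMulti ℝ d x) (exteriorPower.ιMulti ℝ d y) =
      (Matrix.of fun i j => B (x j) (y i)).det := by
  rw [wedgeForm, LinearMap.comp_apply, exteriorPower.map_apply_ιMulti,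
    exteriorPower.pairingDual_ιMulti_ιMulti]
  rfl

/-- The wedges of an orthonormal basis are orthonormal for the induced form. Positivity and the
boundedness of linear functionals both follow from this. -/
theorem wedgeForm_self_eq_sum {B : V →ₗ[ℝ] V →ₗ[ℝ] ℝ}
    (b : Module.Basis (Fin (Module.finrank ℝ V)) ℝ V) (hb : ∀ i, B (b i) = b.coord i) (d : ℕ)
    (x : ⋀[ℝ]^d V) :
    wedgeForm B d x x = ∑ s, (b.exteriorPower d).repr x s ^ 2 := by
  have h1 : ∀ s z, wedgeForm B d (b.exteriorPower d s) z = (b.exteriorPower d).repr z s := by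
    intro s z
    rw [wedgeForm, LinearMap.comp_apply, exteriorPower.basis_apply,
      exteriorPower.map_apply_ιMulti_family, exteriorPower.basis_repr_apply,
      exteriorPower.ιMultiDual]
    congr 3
    funext i
    exact hb i
  conv_lhs =>
    arg 1
    rw [← (b.exteriorPower d).sum_repr x, map_sum]
  simp only [map_smul, LinearMap.sum_apply, LinearMap.smul_apply, h1, smul_eq_mul, sq]

theorem exists_abs_le_sqrt_wedgeForm [FiniteDimensional ℝ V] {B : V →ₗ[ℝ] V →ₗ[ℝ] ℝ} (hB : IsInnerProduct B) (d : ℕ)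
    (φ : Module.Dual ℝ (⋀[ℝ]^d V)) :
    ∃ C : ℝ, 0 ≤ C ∧ ∀ x, |φ x| ≤ C * √(wedgeForm B d x x) := by
  obtain ⟨b, hb⟩ := exists_orthonormal_basis hB
  refine ⟨∑ s, |φ (b.exteriorPower d s)|, Finset.sum_nonneg fun _ _ => abs_nonneg _, fun x => ?_⟩
  rw [wedgeForm_self_eq_sum b hb]
  conv_lhs => rw [← (b.exteriorPower d).sum_repr x, map_sum]
  refine (Finset.abs_sum_le_sum_abs _ _).trans ?_
  rw [Finset.sum_mul]
  refine Finset.sum_le_sum fun s _ => ?_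
  rw [map_smul, smul_eq_mul, abs_mul, mul_comm]
  refine mul_le_mul_of_nonneg_left ?_ (abs_nonneg _)
  refine Real.abs_le_sqrt ?_
  exact Finset.single_le_sum (f := fun s => (b.exteriorPower d).repr x s ^ 2)
    (fun _ _ => sq_nonneg _) (Finset.mem_univ s)

theorem wedgeForm_self_nonneg [FiniteDimensional ℝ V] {B : V →ₗ[ℝ] V →ₗ[ℝ] ℝ} (hB : IsInnerProduct B) {d : ℕ}
    (x : ⋀[ℝ]^d V) : 0 ≤ wedgeForm B d x x := by
  obtain ⟨b, hb⟩ := exists_orthonormal_basis hB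
  rw [wedgeForm_self_eq_sum b hb]
  exact Finset.sum_nonneg fun _ _ => sq_nonneg _

end Euclidean

/-! ### Plücker coordinates -/

section Pluecker

variable {N : ℕ}

/-- The matrix entry at `ij`, as a functional on `sl_N(ℚ)`. -/
def entryQ (ij : Fin N × Fin N) : Module.Dual ℚ (sl (Fin N) ℚ) where
  toFun X := X.1 ij.1 ij.2
  map_add' _ _ := rfl
  map_smul' _ _ := rfl

/-- The matrix entry at `ij`, as a functional on real matrices. -/
def entryR (ij : Fin N × Fin N) : Module.Dual ℝ (Matrix (Fin N) (Fin N) ℝ) where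
  toFun X := X ij.1 ij.2
  map_add' _ _ := rfl
  map_smul' _ _ := rfl

/-- The Plücker coordinate at `J` on the exterior power of `sl_N(ℚ)`. -/
def plueckerQ {d : ℕ} (J : Fin d → Fin N × Fin N) : Module.Dual ℚ (⋀[ℚ]^d (sl (Fin N) ℚ)) :=
  exteriorPower.pairingDual ℚ _ d (exteriorPower.ιMulti ℚ d fun l => entryQ (J l))

/-- The Plücker coordinate at `J` on the exterior power of real matrices. -/
def plueckerR {d : ℕ} (J : Fin d → Fin N × Fin N) :
    Module.Dual ℝ (⋀[ℝ]^d (Matrix (Fin N) (Fin N) ℝ)) :=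
  exteriorPower.pairingDual ℝ _ d (exteriorPower.ιMulti ℝ d fun l => entryR (J l))

theorem plueckerQ_ιMulti {d : ℕ} (J : Fin d → Fin N × Fin N) (x : Fin d → sl (Fin N) ℚ) :
    plueckerQ J (exteriorPower.ιMulti ℚ d x) =
      (Matrix.of fun i j => (x i).1 (J j).1 (J j).2).det :=
  exteriorPower.pairingDual_ιMulti_ιMulti _ _

theorem wedgeToReal_ιMulti {d : ℕ} (x : Fin d → sl (Fin N) ℚ) :
    wedgeToReal N d (exteriorPower.ιMulti ℚ d x) =
      exteriorPower.ιMulti ℝ d fun i => slToReal N (x i) := by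
  rw [wedgeToReal, exteriorPower.alternatingMapLinearEquiv_apply_ιMulti]
  rfl

/-- This compares the arithmetic of `v_M`, whose rational Plücker coordinates are integers, with its
Euclidean norm. -/
theorem plueckerR_wedgeToReal {d : ℕ} (J : Fin d → Fin N × Fin N)
    (v : ⋀[ℚ]^d (sl (Fin N) ℚ)) : plueckerR J (wedgeToReal N d v) = (plueckerQ J v : ℝ) := by
  have hv : v ∈ Submodule.span ℚ (Set.range (exteriorPower.ιMulti ℚ d (M := sl (Fin N) ℚ))) := by
    rw [exteriorPower.ιMulti_span]; trivial
  induction hv using Submodule.span_induction with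
  | zero => simp
  | add x y _ _ hx hy => simp [hx, hy]
  | smul c x _ hx =>
    rw [(wedgeToReal N d).map_smul, (plueckerQ J).map_smul, smul_eq_mul, Rat.cast_mul, ← hx,
      ← Rat.cast_smul_eq_qsmul ℝ, (plueckerR J).map_smul, smul_eq_mul]
  | mem x hx =>
    obtain ⟨x, rfl⟩ := hx
    rw [wedgeToReal_ιMulti, plueckerQ_ιMulti, plueckerR, exteriorPower.pairingDual_ιMulti_ιMulti]
    have h : ((Matrix.of fun i j => (x i).1 (J j).1 (J j).2).det : ℝ) =
        (Rat.castHom ℝ) (Matrix.of fun i j => (x i).1 (J j).1 (J j).2).det := rfl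
    rw [h, RingHom.map_det]
    rfl

theorem plueckerQ_mem_int {d : ℕ} (J : Fin d → Fin N × Fin N) {v : ⋀[ℚ]^d (sl (Fin N) ℚ)}
    (hv : v ∈ wedgeLattice N d) : ∃ n : ℤ, plueckerQ J v = n := by
  induction hv using Submodule.span_induction with
  | zero => exact ⟨0, by simp⟩
  | add x y _ _ hx hy =>
    obtain ⟨m, hm⟩ := hx
    obtain ⟨n, hn⟩ := hy
    exact ⟨m + n, by simp [hm, hn]⟩
  | smul c x _ hx =>
    obtain ⟨m, hm⟩ := hx
    exact ⟨c * m, by simp [hm]⟩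
  | mem x hx =>
    obtain ⟨X, rfl⟩ := hx
    refine ⟨(Matrix.of fun i j => (X i).1 (J j).1 (J j).2).det, ?_⟩
    have h : ((Matrix.of fun i j => (X i).1 (J j).1 (J j).2).det : ℚ) =
        (Int.castRingHom ℚ) (Matrix.of fun i j => (X i).1 (J j).1 (J j).2).det := rfl
    rw [plueckerQ_ιMulti, h, RingHom.map_det]
    rfl

theorem ιMulti_mem_wedgeLattice {d : ℕ} {x : Fin d → sl (Fin N) ℚ} (hx : ∀ l, IsIntMat (x l).1) :
    exteriorPower.ιMulti ℚ d x ∈ wedgeLattice N d := by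
  choose n hn using hx
  have htr : ∀ l, Matrix.trace (Matrix.of fun i j => n l i j) = 0 := by
    intro l
    have h : Matrix.trace (x l).1 = 0 := LinearMap.mem_ker.mp (x l).2
    simp only [Matrix.trace, Matrix.diag_apply, hn, Matrix.of_apply] at h ⊢
    exact_mod_cast h
  refine Submodule.subset_span ⟨fun l => ⟨Matrix.of fun i j => n l i j,
    LinearMap.mem_ker.mpr (htr l)⟩, ?_⟩
  refine congrArg (exteriorPower.ιMulti ℚ d) (funext fun l => ?_)
  ext i j
  exact (hn l i j).symm

theorem exists_eq_smul_ιMulti {M : Subgroup (SLN N)} (w : Module.Basis (Fin (gdim M)) ℚ (lieAlg M))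
    {v : ⋀[ℚ]^(gdim M) (sl (Fin N) ℚ)} (hv : v ∈ wedgeLine M) :
    ∃ c : ℚ, v = c • exteriorPower.ιMulti ℚ (gdim M) fun l => (w l).1 := by
  obtain ⟨u, rfl⟩ := hv
  have hu : u ∈ Submodule.span ℚ
      (Set.range (exteriorPower.ιMulti ℚ (gdim M) (M := lieAlg M))) := by
    rw [exteriorPower.ιMulti_span]; trivial
  induction hu using Submodule.span_induction with
  | zero => exact ⟨0, by simp⟩
  | add x y _ _ hx hy =>
    obtain ⟨m, hm⟩ := hx
    obtain ⟨n, hn⟩ := hy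
    exact ⟨m + n, by rw [map_add, hm, hn, add_smul]⟩
  | smul c x _ hx =>
    obtain ⟨m, hm⟩ := hx
    exact ⟨c * m, by rw [map_smul, hm, mul_smul]⟩
  | mem x hx =>
    obtain ⟨x, rfl⟩ := hx
    refine ⟨w.det x, ?_⟩
    -- A top-degree alternating map is determined by its value on a basis, hence is a multiple of
    -- the determinant.
    have h : exteriorPower.ιMulti ℚ (gdim M) (M := lieAlg M) =
        (LinearMap.toSpanSingleton ℚ _ (exteriorPower.ιMulti ℚ (gdim M) w)).compAlternatingMap
          w.det := by
      refine Module.Basis.ext_alternating w fun σ hσ => ?_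
      let τ : Equiv.Perm (Fin (gdim M)) := Equiv.ofBijective σ hσ.bijective_of_finite
      change exteriorPower.ιMulti ℚ (gdim M) (w ∘ τ) = LinearMap.compAlternatingMap _ _ (w ∘ τ)
      rw [AlternatingMap.map_perm, AlternatingMap.map_perm]
      simp [Module.Basis.det_self]
    rw [h]
    simp [LinearMap.toSpanSingleton_apply, exteriorPower.map_apply_ιMulti]
    rfl

theorem wedgeVec_spec (M : Subgroup (SLN N)) : IsPrimitiveVec M (wedgeVec M) :=
  Classical.choose_spec (exists_isPrimitiveVec M)

/-- The Lie algebra of `M` has an integral basis bounded by a Plücker coordinate of `v_M`. -/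
theorem exists_integral_basis (M : Subgroup (SLN N)) :
    ∃ (y : Module.Basis (Fin (gdim M)) ℚ (lieAlg M)) (J : Fin (gdim M) → Fin N × Fin N),
      1 ≤ |plueckerQ J (wedgeVec M)| ∧ (∀ l, IsIntMat (y l).1.1) ∧
        ∀ l i j, |(y l).1.1 i j| ≤ |plueckerQ J (wedgeVec M)| := by
  classical
  obtain ⟨hline, hlat, hne, -⟩ := wedgeVec_spec M
  obtain ⟨w, J, hrepr, hle⟩ := exists_auerbach_basis (Module.finBasis ℚ (lieAlg M))
    (fun ij => entryQ ij ∘ₗ (lieAlg M).subtype) (by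
      intro x hx
      ext i j
      exact hx (i, j))
  change Module.Basis (Fin (gdim M)) ℚ (lieAlg M) at w
  change Fin (gdim M) → Fin N × Fin N at J
  have hrepr' : ∀ l x, w.repr x l = x.1.1 (J l).1 (J l).2 := hrepr
  have hle' : ∀ l i j, |(w l).1.1 i j| ≤ 1 := fun l i j => hle (i, j) l
  obtain ⟨c, hc⟩ := exists_eq_smul_ιMulti w hline
  have hc0 : c ≠ 0 := by
    rintro rfl
    rw [zero_smul] at hc
    exact hne hc
  have hdual : ∀ l m, (w l).1.1 (J m).1 (J m).2 = (1 : Matrix (Fin (gdim M)) (Fin (gdim M)) ℚ) l m := by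
    intro l m
    rw [← hrepr', w.repr_self, Matrix.one_apply, Finsupp.single_apply]
  -- The minor of `w` at `J` is the identity matrix, so the scaling factor is itself a Plücker
  -- coordinate.
  have hcJ : plueckerQ J (wedgeVec M) = c := by
    rw [hc, map_smul, plueckerQ_ιMulti]
    simp only [hdual, smul_eq_mul]
    have : (Matrix.of fun i j => (1 : Matrix (Fin (gdim M)) (Fin (gdim M)) ℚ) i j) = 1 := rfl
    rw [this, Matrix.det_one, mul_one]
  have hint : ∀ l, IsIntMat (c • (w l).1.1) := by
    intro l i j
    -- Replacing `J l` by `(i, j)` changes one column of the identity minor, and the determinant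
    -- becomes the entry of `w l` at `(i, j)`. So every entry of `c • w l` is a Plücker coordinate
    -- of `v_M`, hence an integer.
    obtain ⟨n, hn⟩ := plueckerQ_mem_int (Function.update J l (i, j)) hlat
    refine ⟨n, ?_⟩
    rw [← hn, hc, map_smul, plueckerQ_ιMulti, smul_eq_mul, Matrix.smul_apply, smul_eq_mul]
    congr 1
    have h1 : (Matrix.of fun k m => (w k).1.1 (Function.update J l (i, j) m).1
        (Function.update J l (i, j) m).2) =
        (1 : Matrix (Fin (gdim M)) (Fin (gdim M)) ℚ).updateCol l fun k => (w k).1.1 i j := by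
      ext k m
      by_cases hm : m = l
      · subst hm; simp
      · simp [hm, hdual]
    rw [h1, ← Matrix.cramer_apply, Matrix.cramer_one]
    rfl
  have hunit : ∀ _ : Fin (gdim M), IsUnit c := fun _ => isUnit_iff_ne_zero.mpr hc0
  refine ⟨w.isUnitSMul hunit, J, ?_, ?_, ?_⟩
  · obtain ⟨n, hn⟩ := plueckerQ_mem_int J hlat
    have hn0 : n ≠ 0 := by
      rintro rfl
      rw [hcJ, Int.cast_zero] at hn
      exact hc0 hn
    rw [hn]
    exact_mod_cast Int.one_le_abs hn0
  · intro l
    rw [Module.Basis.isUnitSMul_apply]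
    exact hint l
  · intro l i j
    rw [Module.Basis.isUnitSMul_apply, hcJ]
    change |c * (w l).1.1 i j| ≤ |c|
    rw [abs_mul]
    exact mul_le_of_le_one_right (abs_nonneg _) (hle' l i j)

/-- A lattice vector on the line of `M` is an integral multiple of `v_M`. -/
theorem exists_eq_zsmul_wedgeVec {M : Subgroup (SLN N)} {w : ⋀[ℚ]^(gdim M) (sl (Fin N) ℚ)}
    (hw : w ∈ wedgeLine M) (hwL : w ∈ wedgeLattice N (gdim M)) :
    ∃ n : ℤ, w = n • wedgeVec M := by
  obtain ⟨hline, hlat, hne, hprim⟩ := wedgeVec_spec M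
  let b : Module.Basis (Fin (gdim M)) ℚ (lieAlg M) := Module.finBasis ℚ (lieAlg M)
  obtain ⟨c, hc⟩ := exists_eq_smul_ιMulti b hline
  obtain ⟨c', hc'⟩ := exists_eq_smul_ιMulti b hw
  have hc0 : c ≠ 0 := by
    rintro rfl
    rw [zero_smul] at hc
    exact hne hc
  have hq : w = (c' / c) • wedgeVec M := by
    rw [hc, smul_smul, div_mul_cancel₀ _ hc0, hc']
  set q := c' / c with hqdef
  have hden : (q.den : ℤ) • w = q.num • wedgeVec M := by
    rw [hq, ← Int.cast_smul_eq_zsmul ℚ, ← Int.cast_smul_eq_zsmul ℚ, smul_smul]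
    congr 1
    rw [mul_comm]
    exact_mod_cast Rat.mul_den_eq_num q
  have hcop : IsCoprime q.num (q.den : ℤ) := by
    rw [Int.isCoprime_iff_gcd_eq_one]
    exact q.reduced
  obtain ⟨r, s, hrs⟩ := hcop
  -- Bézout for the numerator and denominator of `q` exhibits `v_M` as `q.den` times a lattice
  -- vector; primitivity forces `q.den = 1`.
  have hv : wedgeVec M = (q.den : ℤ) • (r • w + s • wedgeVec M) := by
    calc wedgeVec M = (r * q.num + s * q.den) • wedgeVec M := by rw [hrs, one_smul]
      _ = r • (q.num • wedgeVec M) + (q.den : ℤ) • s • wedgeVec M := by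
          rw [add_smul, mul_smul, mul_comm s, mul_smul]
      _ = _ := by rw [← hden, smul_add, smul_comm r]
  have hu := hprim _ _ (Submodule.add_mem _ (Submodule.smul_mem _ r hwL)
    (Submodule.smul_mem _ s hlat)) hv
  have hd1 : q.den = 1 := by
    rcases Int.isUnit_iff.mp hu with h | h <;> omega
  rw [hd1, Nat.cast_one, one_smul] at hden
  exact ⟨q.num, hden⟩

end Pluecker

/-! ### Comparison of heights -/

section Heights

attribute [local instance 100] LieRing.ofAssociativeRing

variable {N : ℕ}

theorem gdim_le (M : Subgroup (SLN N)) : gdim M ≤ N ^ 2 := by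
  have h1 : gdim M ≤ Module.finrank ℚ (sl (Fin N) ℚ) := Submodule.finrank_le _
  have h2 := LinearMap.finrank_le_finrank_of_injective (f := (sl (Fin N) ℚ).toSubmodule.subtype)
    Subtype.val_injective
  rw [Module.finrank_matrix] at h2
  simp only [Fintype.card_fin, Module.finrank_self, mul_one] at h2
  rw [sq]
  exact h1.trans h2

/-- A crude bound for the operator norm of `B` with respect to the maximum of the entries. -/
def formBound (B : Matrix (Fin N) (Fin N) ℝ →ₗ[ℝ] Matrix (Fin N) (Fin N) ℝ →ₗ[ℝ] ℝ) : ℝ :=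
  ∑ p : Fin N × Fin N, ∑ q : Fin N × Fin N,
    |B (Matrix.stdBasis ℝ (Fin N) (Fin N) p) (Matrix.stdBasis ℝ (Fin N) (Fin N) q)|

theorem formBound_nonneg
    (B : Matrix (Fin N) (Fin N) ℝ →ₗ[ℝ] Matrix (Fin N) (Fin N) ℝ →ₗ[ℝ] ℝ) : 0 ≤ formBound B :=
  Finset.sum_nonneg fun _ _ => Finset.sum_nonneg fun _ _ => abs_nonneg _

theorem abs_form_le (B : Matrix (Fin N) (Fin N) ℝ →ₗ[ℝ] Matrix (Fin N) (Fin N) ℝ →ₗ[ℝ] ℝ) {Z : ℝ}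
    (hZ : 0 ≤ Z) {x y : Matrix (Fin N) (Fin N) ℝ} (hx : ∀ i j, |x i j| ≤ Z)
    (hy : ∀ i j, |y i j| ≤ Z) : |B x y| ≤ formBound B * Z ^ 2 := by
  let b := Matrix.stdBasis ℝ (Fin N) (Fin N)
  have hr : ∀ (z : Matrix (Fin N) (Fin N) ℝ) p, b.repr z p = z p.1 p.2 := fun _ _ => rfl
  have h : B x y = ∑ p, ∑ q, x p.1 p.2 * (y q.1 q.2 * B (b p) (b q)) := by
    conv_lhs => rw [← b.sum_repr x, ← b.sum_repr y]
    simp only [map_sum, map_smul, LinearMap.sum_apply, LinearMap.smul_apply, smul_eq_mul, hr,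
      Finset.mul_sum]
    rw [Finset.sum_comm]
    exact Finset.sum_congr rfl fun p _ => Finset.sum_congr rfl fun q _ => by ring
  rw [h, formBound, Finset.sum_mul]
  refine (Finset.abs_sum_le_sum_abs _ _).trans (Finset.sum_le_sum fun p _ => ?_)
  rw [Finset.sum_mul]
  refine (Finset.abs_sum_le_sum_abs _ _).trans (Finset.sum_le_sum fun q _ => ?_)
  rw [abs_mul, abs_mul, ← mul_assoc, mul_comm, sq]
  refine mul_le_mul_of_nonneg_left ?_ (abs_nonneg _)
  exact mul_le_mul (hx _ _) (hy _ _) (abs_nonneg _) hZ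

theorem height_nonneg (B : Matrix (Fin N) (Fin N) ℝ →ₗ[ℝ] Matrix (Fin N) (Fin N) ℝ →ₗ[ℝ] ℝ)
    (M : Subgroup (SLN N)) : 0 ≤ height B M := Real.sqrt_nonneg _

/-- The wedge of an integral basis is `n • v` with `v` primitive and `n` a nonzero integer, so its
norm is at least the height. Its squared norm is a Gram determinant, estimated entry by entry. -/
theorem height_le_of_basis {B : Matrix (Fin N) (Fin N) ℝ →ₗ[ℝ] Matrix (Fin N) (Fin N) ℝ →ₗ[ℝ] ℝ}
    (hB : IsInnerProduct B) (M : Subgroup (SLN N)) (x : Module.Basis (Fin (gdim M)) ℚ (lieAlg M))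
    (hx : ∀ l, IsIntMat (x l).1.1) {Z : ℝ} (hZ : 0 ≤ Z)
    (hxZ : ∀ l i j, |((x l).1.1 i j : ℝ)| ≤ Z) :
    height B M ^ 2 ≤ (gdim M).factorial * (formBound B * Z ^ 2) ^ gdim M := by
  obtain ⟨hline, hlat, hne, -⟩ := wedgeVec_spec M
  set w := exteriorPower.ιMulti ℚ (gdim M) fun l => (x l).1 with hw
  have hwline : w ∈ wedgeLine M := by
    refine ⟨exteriorPower.ιMulti ℚ (gdim M) x, ?_⟩
    rw [exteriorPower.map_apply_ιMulti]
    rfl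
  obtain ⟨n, hn⟩ := exists_eq_zsmul_wedgeVec hwline (ιMulti_mem_wedgeLattice hx)
  have hw0 : w ≠ 0 := by
    intro h
    obtain ⟨c, hc⟩ := exists_eq_smul_ιMulti x hline
    rw [← hw, h, smul_zero] at hc
    exact hne hc
  have hn0 : n ≠ 0 := by
    rintro rfl
    rw [zero_smul] at hn
    exact hw0 hn
  have hnn := wedgeForm_self_nonneg hB (wedgeToReal N (gdim M) (wedgeVec M))
  have hform : wedgeForm B (gdim M) (wedgeToReal N (gdim M) w) (wedgeToReal N (gdim M) w) =
      (n : ℝ) ^ 2 * wedgeForm B (gdim M) (wedgeToReal N (gdim M) (wedgeVec M))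
        (wedgeToReal N (gdim M) (wedgeVec M)) := by
    rw [hn, map_zsmul, ← Int.cast_smul_eq_zsmul ℝ, map_smul, map_smul, LinearMap.smul_apply,
      smul_eq_mul, smul_eq_mul, sq, mul_assoc]
  have hn1 : (1 : ℝ) ≤ (n : ℝ) ^ 2 := by
    have h1 : 1 ≤ n ^ 2 := Int.one_le_abs (pow_ne_zero 2 hn0) |>.trans_eq (abs_of_nonneg (sq_nonneg n))
    exact_mod_cast h1
  have hdet : wedgeForm B (gdim M) (wedgeToReal N (gdim M) w) (wedgeToReal N (gdim M) w) ≤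
      (gdim M).factorial * (formBound B * Z ^ 2) ^ gdim M := by
    rw [hw, wedgeToReal_ιMulti, wedgeForm_ιMulti]
    refine (le_abs_self _).trans ?_
    have := Matrix.det_le (A := Matrix.of fun i j : Fin (gdim M) =>
      B (slToReal N (x j).1) (slToReal N (x i).1)) (abv := AbsoluteValue.abs)
      (x := formBound B * Z ^ 2) (fun i j => abs_form_le B hZ (hxZ j) (hxZ i))
    simpa using this
  rw [height, Real.sq_sqrt hnn]
  calc _ ≤ (n : ℝ) ^ 2 * wedgeForm B (gdim M) (wedgeToReal N (gdim M) (wedgeVec M))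
        (wedgeToReal N (gdim M) (wedgeVec M)) := le_mul_of_one_le_left hnn hn1
    _ ≤ _ := by rw [← hform]; exact hdet

/-- A basis of the span of a finite family, chosen from the family. -/
theorem exists_basis_of_spanning {W : Type*} [AddCommGroup W] [Module ℚ W] {ι : Type*}
    (U : Submodule ℚ W) [FiniteDimensional ℚ U] (z : ι → W)
    (hz : Submodule.span ℚ (Set.range z) = U) :
    ∃ (x : Module.Basis (Fin (Module.finrank ℚ U)) ℚ U) (a : Fin (Module.finrank ℚ U) → ι),
      ∀ l, (x l).1 = z (a l) := by
  obtain ⟨κ, a, -, ha, hli⟩ := exists_linearIndependent' ℚ z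
  let b := (Module.Basis.span hli).map (LinearEquiv.ofEq _ _ (ha.trans hz))
  have hb : ∀ k, (b k).1 = z (a k) := fun k => by
    simp [b, Module.Basis.span_apply]
  have : Finite κ := Module.Finite.finite_basis b
  have : Fintype κ := Fintype.ofFinite κ
  let e := Fintype.equivFinOfCardEq (Module.finrank_eq_card_basis b).symm
  exact ⟨b.reindex e, fun l => a (e.symm l), fun l => by rw [Module.Basis.reindex_apply, hb]⟩

/-- The constant is uniform in `M` because `gdim M ≤ N²` leaves only finitely many pairs `(d, J)`;
their individual constants are summed. -/
theorem exists_abs_pluecker_le {B : Matrix (Fin N) (Fin N) ℝ →ₗ[ℝ] Matrix (Fin N) (Fin N) ℝ →ₗ[ℝ] ℝ}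
    (hB : IsInnerProduct B) :
    ∃ C : ℝ, 0 < C ∧ ∀ (M : Subgroup (SLN N)) (J : Fin (gdim M) → Fin N × Fin N),
      ((|plueckerQ J (wedgeVec M)| : ℚ) : ℝ) ≤ C * height B M := by
  choose c hc hcle using fun (d : ℕ) (J : Fin d → Fin N × Fin N) =>
    exists_abs_le_sqrt_wedgeForm hB d (plueckerR J)
  have hsum : ∀ d, 0 ≤ ∑ J : Fin d → Fin N × Fin N, c d J := fun d =>
    Finset.sum_nonneg fun J _ => hc d J
  refine ⟨(∑ d ∈ Finset.range (N ^ 2 + 1), ∑ J : Fin d → Fin N × Fin N, c d J) + 1,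
    add_pos_of_nonneg_of_pos (Finset.sum_nonneg fun d _ => hsum d) one_pos, fun M J => ?_⟩
  have h1 := hcle (gdim M) J (wedgeToReal N (gdim M) (wedgeVec M))
  rw [plueckerR_wedgeToReal] at h1
  push_cast
  refine h1.trans (mul_le_mul_of_nonneg_right ?_ (height_nonneg B M))
  have h2 : c (gdim M) J ≤ ∑ J, c (gdim M) J :=
    Finset.single_le_sum (fun J _ => hc (gdim M) J) (Finset.mem_univ J)
  have h3 : ∑ J, c (gdim M) J ≤
      ∑ d ∈ Finset.range (N ^ 2 + 1), ∑ J : Fin d → Fin N × Fin N, c d J :=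
    Finset.single_le_sum (f := fun d => ∑ J : Fin d → Fin N × Fin N, c d J) (fun d _ => hsum d)
      (Finset.mem_range.mpr (Nat.lt_succ_of_le (gdim_le M)))
  linarith

/-- The constant in the bound for integral vectors in the Lie algebra of a normal subgroup. -/
def entryConst (N : ℕ) : ℝ :=
  ((N ^ 2 : ℕ) : ℝ) ^ 2 * (N ^ 2).factorial * (4 * N ^ 4 + 1) ^ (N ^ 2 + 1) + 1

theorem one_le_entryConst (N : ℕ) : 1 ≤ entryConst N :=
  le_add_of_nonneg_left (by positivity)

theorem entry_bound_le (N : ℕ) {d : ℕ} (hd : d ≤ N ^ 2) {H : ℝ} (hH : 1 ≤ H) :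
    (d : ℝ) * (d * ((4 * N ^ 4 + 1) * H ^ 2 * (d.factorial * ((4 * N ^ 4 + 1) * H ^ 2) ^ d)) * H) ≤
      entryConst N * H ^ (2 * N ^ 2 + 3) := by
  set a : ℝ := 4 * N ^ 4 + 1
  have ha : 1 ≤ a := le_add_of_nonneg_left (by positivity)
  have hβ : 1 ≤ a * H ^ 2 := one_le_mul_of_one_le_of_one_le ha (one_le_pow₀ hH)
  have hd' : (d : ℝ) ≤ ((N ^ 2 : ℕ) : ℝ) := by exact_mod_cast hd
  have hf : (d.factorial : ℝ) ≤ ((N ^ 2).factorial : ℝ) := by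
    exact_mod_cast Nat.factorial_le hd
  have hp : (a * H ^ 2) ^ d ≤ (a * H ^ 2) ^ (N ^ 2) := pow_le_pow_right₀ hβ hd
  have hH0 : 0 ≤ H := by linarith
  have ha0 : 0 ≤ a := by linarith
  calc (d : ℝ) * (d * (a * H ^ 2 * (d.factorial * (a * H ^ 2) ^ d)) * H)
      ≤ ((N ^ 2 : ℕ) : ℝ) * (((N ^ 2 : ℕ) : ℝ) *
          (a * H ^ 2 * ((N ^ 2).factorial * (a * H ^ 2) ^ (N ^ 2))) * H) := by gcongr
    _ = ((N ^ 2 : ℕ) : ℝ) ^ 2 * (N ^ 2).factorial * a ^ (N ^ 2 + 1) * H ^ (2 * N ^ 2 + 3) := by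
        rw [mul_pow, ← pow_mul, pow_succ a, pow_add H]
        ring
    _ ≤ _ := by
        refine mul_le_mul_of_nonneg_right ?_ (by positivity)
        exact le_add_of_nonneg_right zero_le_one

end Heights

end HeightNormal

end

/-! ### The polynomial bound for the height of a normal subgroup -/

theorem lemma7p5 (N : ℕ) :
    ∃ k : ℝ, 0 < k ∧
      ∀ B : Matrix (Fin N) (Fin N) ℝ →ₗ[ℝ] Matrix (Fin N) (Fin N) ℝ →ₗ[ℝ] ℝ,
        HeightNormal.IsInnerProduct B →
        ∃ C : ℝ, 0 < C ∧
          ∀ M M' : Subgroup (Matrix.SpecialLinearGroup (Fin N) ℂ),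
            HeightNormal.IsQSubgroup M → HeightNormal.IsSemisimpleGroup M →
            HeightNormal.IsQSubgroup M' → M' ≤ M → (M'.subgroupOf M).Normal →
            HeightNormal.height B M' ≤ C * HeightNormal.height B M ^ k := by
  open HeightNormal in
  set n := N ^ 2
  -- The spanning vectors have size `H^(2n+3)`: `2` from `K'`, `2n` from the adjugate, `1` from `y`.
  -- A wedge of at most `n` of them contributes the power `n`, and the final `+ 1` keeps the
  -- exponent positive when `N = 0`.
  refine ⟨((((2 * n + 3) * n + 1 : ℕ)) : ℝ), by positivity, fun B hB => ?_⟩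
  obtain ⟨C, hC, hCle⟩ := exists_abs_pluecker_le hB
  -- With `c ≥ 1`, the power `gdim M'` can be raised to the uniform power `n`.
  set c : ℝ := formBound B + 1 with hc
  have hc1 : 1 ≤ c := le_add_of_nonneg_left (formBound_nonneg B)
  have hE := one_le_entryConst N
  have hfac : (0 : ℝ) < n.factorial := by exact_mod_cast n.factorial_pos
  refine ⟨√(n.factorial * c ^ n) * entryConst N ^ n * C ^ ((2 * n + 3) * n + 1), by positivity,
    fun M M' hM hss _ hle hnorm => ?_⟩
  obtain ⟨y, J, hJ, hyint, hyle⟩ := exists_integral_basis M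
  obtain ⟨z, hzspan, hzint, hzle⟩ := exists_bounded_spanning hM hss hle hnorm y hJ hyint hyle
  obtain ⟨x, a, hxa⟩ : ∃ (x : Module.Basis (Fin (gdim M')) ℚ (lieAlg M'))
      (a : Fin (gdim M') → Fin (gdim M)), ∀ l, (x l).1 = z (a l) :=
    exists_basis_of_spanning (lieAlg M') z hzspan
  have hHle := hCle M J
  generalize |plueckerQ J (wedgeVec M)| = q at hJ hyle hzle hHle
  set H : ℝ := (q : ℝ) with hHdef
  have hH1 : 1 ≤ H := by rw [hHdef]; exact_mod_cast hJ
  set Z : ℝ := entryConst N * H ^ (2 * n + 3) with hZdef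
  have hZ1 : 1 ≤ Z := one_le_mul_of_one_le_of_one_le hE (one_le_pow₀ hH1)
  have hsq := height_le_of_basis hB M' x (fun l => by rw [hxa]; exact hzint _)
    (zero_le_one.trans hZ1) (fun l i j => by
      rw [hxa]
      refine le_trans ?_ (entry_bound_le N (gdim_le M) hH1)
      rw [hHdef]
      exact_mod_cast hzle (a l) i j)
  have hsq' : height B M' ^ 2 ≤ n.factorial * (c * Z ^ 2) ^ n := by
    refine hsq.trans ?_
    have h1 : formBound B * Z ^ 2 ≤ c * Z ^ 2 := by
      gcongr
      exact le_add_of_nonneg_right zero_le_one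
    have h2 : (1 : ℝ) ≤ c * Z ^ 2 := one_le_mul_of_one_le_of_one_le hc1 (one_le_pow₀ hZ1)
    have h3 : ((gdim M').factorial : ℝ) ≤ n.factorial := by
      exact_mod_cast Nat.factorial_le (gdim_le M')
    have h4 : 0 ≤ formBound B * Z ^ 2 := mul_nonneg (formBound_nonneg B) (sq_nonneg _)
    calc _ ≤ (n.factorial : ℝ) * (c * Z ^ 2) ^ gdim M' := by gcongr
      _ ≤ _ := by
        exact mul_le_mul_of_nonneg_left (pow_le_pow_right₀ h2 (gdim_le M')) hfac.le
  have hmain : height B M' ≤ √(n.factorial * c ^ n) * Z ^ n := by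
    have h1 := Real.le_sqrt_of_sq_le hsq'
    have h2 : (n.factorial : ℝ) * (c * Z ^ 2) ^ n = n.factorial * c ^ n * (Z ^ n) ^ 2 := by
      rw [mul_pow, ← pow_mul, ← pow_mul, mul_comm 2 n, mul_assoc]
    rw [h2, Real.sqrt_mul' _ (sq_nonneg _), Real.sqrt_sq (by positivity)] at h1
    exact h1
  rw [Real.rpow_natCast]
  calc height B M' ≤ √(n.factorial * c ^ n) * Z ^ n := hmain
    _ = √(n.factorial * c ^ n) * entryConst N ^ n * H ^ ((2 * n + 3) * n) := by
        rw [hZdef, mul_pow, ← pow_mul, mul_assoc]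
    _ ≤ √(n.factorial * c ^ n) * entryConst N ^ n * H ^ ((2 * n + 3) * n + 1) := by
        refine mul_le_mul_of_nonneg_left ?_ (by positivity)
        exact pow_le_pow_right₀ hH1 (Nat.le_succ _)
    _ ≤ √(n.factorial * c ^ n) * entryConst N ^ n * (C * height B M) ^ ((2 * n + 3) * n + 1) := by
        gcongr
    _ = _ := by rw [mul_pow, ← mul_assoc]
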